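/- Let $G=A+B$ be a finite bipartite graph with $B=\{b_1,\dots,b_n\}$, and let $g\colon B\to\mathbb N$ be a need function; write $g(B)=\sum_{b\in B}g(b)$. For $F\subseteq E(G)$ let $d_F(v)$ be the number of edges of $F$ incident with $v$. A set $F\subseteq E(G)$ is a $g$-quasi-matching of $B$ if $d_F(b)\ge g(b)$ for all $b\in B$; it is (lexicographically) minimum if there is no $g$-quasi-matching $F'$ of $B$ such that the non-increasing sequence of the $F$-degrees of the vertices of $N(B)\subseteq A$ is lexicographically greater than the corresponding sequence for $F'$. An $F$-augmenting path from $b\in B$ to $a\in A$ is a path whose edges alternate between $E(G)\setminus F$ and $F$, the first and the last edge not being in $F$ (a single edge outside $F$ is allowed). Algorithm 1 starts with $F=\emptyset$. For $\ell=1,\dots,n$ it repeats the following pass $g(b_\ell)$ times: choose, among all $F$-augmenting paths from $b_\ell$ to vertices of $A$ in $G_\ell=G[A\cup\{b_1,\dots,b_\ell\}]$, a path $P$ whose end-vertex $a\in A$ has the smallest possible degree $d_F(a)$, and replace $F$ by $F\oplus E(P)$. Finally it returns $F$. Suppose that $G$ has a $g$-quasi-matching of $B$. Then Algorithm 1 never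 gets stuck (a path $P$ as required exists in every pass), and, whatever choices it makes, the set it returns is a minimum $g$-quasi-matching of $B$. Moreover, if $B\neq\emptyset$ and $g(b)>0$ for all $b\in B$, then Algorithm 1 can be carried out in time $O(g(B)\,|E(G)|)$, with $O(|E(G)|)$ time for each pass: there are a constant $C$ and a program for a unit-cost random access machine, both independent of the input, such that, for every such $G$ (given by a list of its edges) and $g$ with a $g$-quasi-matching of $B$, the program computes one after the other the sets $F_0=\emptyset,F_1,\dots,F_{g(B)}$ of an execution of Algorithm 1, takes at most $C\,|E(G)|$ steps for each pass, and halts with $F_{g(B)}$ after at most $C\,g(B)\,|E(G)|$ steps. (The machine has finitely many registers and arrays of natural numbers; its arithmetic consists of adding and subtracting $1$ and of comparisons.) -/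

import Mathlib

open Finset

namespace QuasiMatching

/-! ### Quasi-matchings in bipartite graphs

A bipartite graph `G = A + B` is a simple graph on the disjoint union `A ⊕ B` all of whose edges
join the two summands, i.e. a graph `G ≤ completeBipartiteGraph A B`. -/

section Matchings

variable {A B : Type*} [DecidableEq A] [DecidableEq B]

/-- The `F`-degree of a vertex: the number of edges of `F` incident with it. -/
def fdeg (F : Finset (Sym2 (A ⊕ B))) (v : A ⊕ B) : ℕ :=
  #{e ∈ F | v ∈ e}

/-- `F` is a `g`-quasi-matching of `Y ⊆ B` in `G`. -/
def IsQuasiMatching (G : SimpleGraph (A ⊕ B)) (g : B → ℕ) (Y : Finset B)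
    (F : Finset (Sym2 (A ⊕ B))) : Prop :=
  (F : Set (Sym2 (A ⊕ B))) ⊆ G.edgeSet ∧ ∀ y ∈ Y, g y ≤ fdeg F (Sum.inr y)

open Classical in
/-- The neighbourhood `N(Y) ⊆ A` of a set `Y ⊆ B`. -/
noncomputable def nbhd [Fintype A] (G : SimpleGraph (A ⊕ B)) (Y : Finset B) : Finset A :=
  {a | ∃ y ∈ Y, G.Adj (Sum.inl a) (Sum.inr y)}

/-- The sequence `d_F(X)` of the `F`-degrees of the vertices of `X ⊆ A`, in non-increasing order. -/
def degSeq (F : Finset (Sym2 (A ⊕ B))) (X : Finset A) : List ℕ :=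
  (X.val.map fun a => fdeg F (Sum.inl a)).sort (· ≥ ·)

/-- `F` is lexicographically greater than `F'` on `Y ⊆ B`: `d_F(N(Y))` is lexicographically greater
than `d_{F'}(N(Y))` (`<` on `List ℕ` is the lexicographic order). -/
def LexGreater [Fintype A] (G : SimpleGraph (A ⊕ B)) (Y : Finset B)
    (F F' : Finset (Sym2 (A ⊕ B))) : Prop :=
  degSeq F' (nbhd G Y) < degSeq F (nbhd G Y)

/-- `F` is a (lexicographically) minimum `g`-quasi-matching of `Y`. -/
def IsMinimum [Fintype A] (G : SimpleGraph (A ⊕ B)) (g : B → ℕ) (Y : Finset B)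
    (F : Finset (Sym2 (A ⊕ B))) : Prop :=
  IsQuasiMatching G g Y F ∧ ∀ F', IsQuasiMatching G g Y F' → ¬ LexGreater G Y F F'

/-! ### The iterative algorithm -/

/-- `P` is an `F`-augmenting path from `y ∈ B` to `a ∈ A`: a path whose edges are alternately
outside and inside `F`, the first edge (at `y`) and the last one (at `a`) being outside `F`.
(The last edge has even position because `G` is bipartite; a single edge outside `F` is allowed.) -/
def IsAugmenting {G : SimpleGraph (A ⊕ B)} (F : Finset (Sym2 (A ⊕ B))) {y : B} {a : A}
    (P : G.Walk (Sum.inr y) (Sum.inl a)) : Prop :=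
  P.IsPath ∧ ∀ i < P.length, (s(P.getVert i, P.getVert (i + 1)) ∈ F ↔ Odd i)

variable {n : ℕ}

/-- The walk `P` lies in `G_ℓ`, the subgraph induced by `A` and the vertices `b_0, …, b_ℓ`
of `B` (which is numbered from `0`). -/
def InStage (b : Fin n ≃ B) (l : Fin n) {G : SimpleGraph (A ⊕ B)} {u v : A ⊕ B}
    (P : G.Walk u v) : Prop :=
  ∀ y : B, Sum.inr y ∈ P.support → b.symm y ≤ l

/-- One pass through the inner loop while `b_ℓ` is processed: choose, among the `F`-augmenting paths
in `G_ℓ` that start at `b_ℓ`, a path `P` whose end-vertex in `A` has the smallest possible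
`F`-degree, and put `F' = F ⊕ E(P)`. -/
def Augments (G : SimpleGraph (A ⊕ B)) (b : Fin n ≃ B) (l : Fin n)
    (F F' : Finset (Sym2 (A ⊕ B))) : Prop :=
  ∃ (a : A) (P : G.Walk (Sum.inr (b l)) (Sum.inl a)),
    IsAugmenting F P ∧ InStage b l P ∧
    (∀ (a' : A) (Q : G.Walk (Sum.inr (b l)) (Sum.inl a')),
      IsAugmenting F Q → InStage b l Q → fdeg F (Sum.inl a) ≤ fdeg F (Sum.inl a')) ∧
    F' = symmDiff F P.edges.toFinset

/-- The two nested loops, unrolled: `b_0` is processed `g(b_0)` times, then `b_1` is processed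
`g(b_1)` times, and so on. -/
def schedule (b : Fin n ≃ B) (g : B → ℕ) : List (Fin n) :=
  (List.finRange n).flatMap fun l => List.replicate (g (b l)) l

/-- Pass number `i` (counted from `0`) through the inner loop of the algorithm may turn
`F` into `F'`. -/
def Pass (G : SimpleGraph (A ⊕ B)) (b : Fin n ≃ B) (g : B → ℕ) (i : ℕ)
    (F F' : Finset (Sym2 (A ⊕ B))) : Prop :=
  ∃ l : Fin n, (schedule b g)[i]? = some l ∧ Augments G b l F F'

/-- `F 0, F 1, …, F k` are the edge sets computed in the first `k` passes of an execution of the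
algorithm. The execution is complete when `k` is the need `g(B)`, and then it returns `F k`. -/
def IsExecution (G : SimpleGraph (A ⊕ B)) (b : Fin n ≃ B) (g : B → ℕ) (k : ℕ)
    (F : ℕ → Finset (Sym2 (A ⊕ B))) : Prop :=
  F 0 = ∅ ∧ ∀ i < k, Pass G b g i (F i) (F (i + 1))

end Matchings

/-! ### A random access machine

Structured programs over finitely many registers and arrays of natural numbers. Every instruction,
and every test of a conditional or a loop, costs one step. The only arithmetic is adding or
subtracting one, so no number in the store ever exceeds
`max (numbers in the input and in the program) + number of steps`. -/

/-- The store: registers, and arrays indexed by natural numbers. -/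
structure Store where
  reg : ℕ → ℕ
  arr : ℕ → ℕ → ℕ

/-- A comparison of two registers. -/
inductive Test where
  | eq (x y : ℕ)
  | ne (x y : ℕ)
  | lt (x y : ℕ)
  | le (x y : ℕ)

/-- Instructions; a program is a list of instructions. -/
inductive Instr where
  /-- `reg x := k` -/
  | const (x k : ℕ)
  /-- `reg x := reg y` -/
  | copy (x y : ℕ)
  /-- `reg x := reg y + 1` -/
  | succ (x y : ℕ)
  /-- `reg x := reg y - 1` (and `0` if `reg y = 0`) -/
  | pred (x y : ℕ)
  /-- `reg x := arr t [reg y]` -/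
  | load (x t y : ℕ)
  /-- `arr t [reg x] := reg y` -/
  | store (t x y : ℕ)
  /-- `if c then p else q` -/
  | ifThenElse (c : Test) (p q : List Instr)
  /-- `while c do p` -/
  | loop (c : Test) (p : List Instr)

def Test.eval (s : Store) : Test → Bool
  | .eq x y => s.reg x == s.reg y
  | .ne x y => s.reg x != s.reg y
  | .lt x y => decide (s.reg x < s.reg y)
  | .le x y => decide (s.reg x ≤ s.reg y)

def Store.setReg (s : Store) (x v : ℕ) : Store :=
  { s with reg := Function.update s.reg x v }

def Store.setArr (s : Store) (t i v : ℕ) : Store :=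
  { s with arr := Function.update s.arr t (Function.update (s.arr t) i v) }

/-- A configuration: the code that remains to be executed, and the store. -/
abbrev Config := List Instr × Store

/-- One step of the machine. The machine has halted when no code remains. -/
def step : Config → Config
  | ([], s) => ([], s)
  | (.const x k :: r, s) => (r, s.setReg x k)
  | (.copy x y :: r, s) => (r, s.setReg x (s.reg y))
  | (.succ x y :: r, s) => (r, s.setReg x (s.reg y + 1))
  | (.pred x y :: r, s) => (r, s.setReg x (s.reg y - 1))
  | (.load x t y :: r, s) => (r, s.setReg x (s.arr t (s.reg y)))
  | (.store t x y :: r, s) => (r, s.setArr t (s.reg x) (s.reg y))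
  | (.ifThenElse c p q :: r, s) => ((if c.eval s then p else q) ++ r, s)
  | (.loop c p :: r, s) => (if c.eval s then p ++ .loop c p :: r else r, s)

/-- The configuration after `t` steps of the program `P` started on the store `s`. -/
def runFor (P : List Instr) (s : Store) (t : ℕ) : Config := step^[t] (P, s)

/-- The value at index `i` of a finite array, extended by `0`. -/
def cell {m : ℕ} (f : Fin m → ℕ) (i : ℕ) : ℕ := if h : i < m then f ⟨i, h⟩ else 0

/-- The edges of a bipartite graph as pairs (end-vertex in `A`, end-vertex in `B`). -/
abbrev EdgePair {A B : Type*} (G : SimpleGraph (A ⊕ B)) :=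
  {q : A × B // G.Adj (Sum.inl q.1) (Sum.inr q.2)}

/-- The initial store for a graph with parts `{0, …, p-1}` and `{0, …, n-1}`, given by a list of
its `m` edges in some order, together with the need function `g`. Registers `0, 1, 2` hold
`p`, `n`, `m`; array `0` holds `g`; arrays `1` and `2` hold the two end-vertices of the edges.
All other cells are `0`. -/
def inputStore {p n m : ℕ} {G : SimpleGraph (Fin p ⊕ Fin n)} (e : Fin m ≃ EdgePair G)
    (g : Fin n → ℕ) : Store where
  reg := fun
    | 0 => p
    | 1 => n
    | 2 => m
    | _ => 0
  arr := fun
    | 0 => cell g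
    | 1 => cell fun k => (e k).1.1
    | 2 => cell fun k => (e k).1.2
    | _ => fun _ => 0

/-- Array `3` of the store `s` is the indicator of the edge set `F`, with respect to the
list `e` of the edges. -/
def Holds {p n m : ℕ} {G : SimpleGraph (Fin p ⊕ Fin n)} (e : Fin m ≃ EdgePair G) (s : Store)
    (F : Finset (Sym2 (Fin p ⊕ Fin n))) : Prop :=
  ∀ k : Fin m, s.arr 3 k = if s(Sum.inl (e k).1.1, Sum.inr (e k).1.2) ∈ F then 1 else 0

/-- On the graph `G` with edge list `e` and on the need function `g`, the program `P` carries out an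
execution `F 0, F 1, …, F (g(B))` of the algorithm: it stores the sets `F i` one after the other in
array `3`, it needs at most `passTime` steps for each pass, and within `totalTime` steps it halts
with the returned set `F (g(B))` in that array. -/
def Implements {p n m : ℕ} (P : List Instr) (G : SimpleGraph (Fin p ⊕ Fin n))
    (e : Fin m ≃ EdgePair G) (g : Fin n → ℕ) (passTime totalTime : ℕ) : Prop :=
  ∃ (F : ℕ → Finset (Sym2 (Fin p ⊕ Fin n))) (t : ℕ → ℕ) (T : ℕ),
    IsExecution G (Equiv.refl (Fin n)) g (∑ y, g y) F ∧
    (∀ i ≤ ∑ y, g y, Holds e (runFor P (inputStore e g) (t i)).2 (F i)) ∧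
    (∀ i < ∑ y, g y, t i ≤ t (i + 1) ∧ t (i + 1) ≤ t i + passTime) ∧
    t (∑ y, g y) ≤ T ∧ T ≤ totalTime ∧
    (runFor P (inputStore e g) T).1 = [] ∧
    Holds e (runFor P (inputStore e g) T).2 (F (∑ y, g y))

end QuasiMatching

/-!
Direct every edge outside `F` from `B` to `A` and every edge of `F` from `A` to `B`; augmenting
paths are then the directed paths from `B` to `A`, and a directed walk shortens to a directed path.

*Correctness.* Call `F` balanced if for every level `k` some set `S` closed under arcs contains
all vertices of `A` of degree above `k` and none of degree below `k`. This excludes a directed walk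
from a vertex of `A` to one whose degree is smaller by at least two, and it passes through an
augmentation (`Augments.balanced`): let `a` be the end of the chosen path `P`, of degree `d`. For
`k > d` the path cannot enter `S`, because `a ∉ S`; for `k ≤ d` the set of all vertices reachable
from `b_l` is added to `S`, where the vertices of `A` have degree at least `d` by the choice of
`P`, and reversing arcs inside the new set keeps it closed. Conversely, counting the edges that
meet `S` shows that a balanced `F` with `d_F ≤ d_{F'}` on `B` minimizes `∑ a, (d_F(a) - k)⁺` for
every `k` (`Balanced.sum_tsub_le`); were its degree sequence lexicographically greater than that of
`F'`, the value of `F'` at the first difference would be a level `k` violating this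
(`exists_sum_tsub_lt_of_lex`). The algorithm never gets stuck: as long as `d_F(b) < g(b) ≤ d_G(b)`,
some edge at `b` lies outside `F`, and such an edge is itself an augmenting path.

*Running time.* The program recomputes all auxiliary data in every pass, in time `O(m)` for `m`
edges. Because `A` may have many more than `m` vertices, no step runs over `A`: a vertex of `A` is
numbered by `n` plus the index of one of its edges, and only cells belonging to ends of edges are
reset. Arcs are gathered into linked lists by their tails; a breadth-first search from `b_l` marks
vertices and stores, for each newly reached vertex, the arc by which it was reached together with
the preceding arc; the out-degree of a vertex of `A` is its `F`-degree, so the best end-vertex is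
found by a pass through the queue, and the path is flipped while it is traced back. The search is
bounded by an amortized count: each arc is scanned once and each vertex dequeued once (`wp_search`).
Since every vertex reachable from `b_l` is marked, the path is an admissible choice (`wp_pass`).
-/

namespace QuasiMatching

/-! ### Alternating walks as directed walks -/

section Combinatorics

variable {A B : Type*} {G : SimpleGraph (A ⊕ B)}

/-- The digraph of `F`: edges outside `F` point from `B` to `A`, edges of `F` from `A` to `B`.
Adjacency in the graph is not part of the definition. -/
def Arc (F : Finset (Sym2 (A ⊕ B))) : A ⊕ B → A ⊕ B → Prop
  | .inr y, .inl a => s(Sum.inr y, Sum.inl a) ∉ F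
  | .inl a, .inr y => s(Sum.inl a, Sum.inr y) ∈ F
  | _, _ => False

/-- A walk is directed if all its steps are arcs; between `B` and `A` this says that it alternates. -/
def Directed (F : Finset (Sym2 (A ⊕ B))) {u v : A ⊕ B} (P : G.Walk u v) : Prop :=
  ∀ d ∈ P.darts, Arc F d.fst d.snd

/-- The sign by which the degree of the first vertex of a directed walk changes when the walk is
flipped; at the last vertex it is the opposite sign. -/
def sgn : A ⊕ B → ℤ
  | .inl _ => -1
  | .inr _ => 1

theorem adj_cases (hG : G ≤ completeBipartiteGraph A B) {u v : A ⊕ B} (h : G.Adj u v) :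
    (∃ a y, u = Sum.inl a ∧ v = Sum.inr y) ∨ ∃ a y, u = Sum.inr y ∧ v = Sum.inl a := by
  have := hG h
  rcases u with a | y <;> rcases v with a' | y' <;> simp_all

@[simp] theorem directed_nil (F : Finset (Sym2 (A ⊕ B))) (u : A ⊕ B) :
    Directed F (SimpleGraph.Walk.nil : G.Walk u u) := by
  simp [Directed]

@[simp] theorem directed_cons {F : Finset (Sym2 (A ⊕ B))} {u v w : A ⊕ B} (h : G.Adj u v)
    (p : G.Walk v w) :
    Directed F (SimpleGraph.Walk.cons h p) ↔ Arc F u v ∧ Directed F p := by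
  simp [Directed]

theorem Directed.append {F : Finset (Sym2 (A ⊕ B))} {u v w : A ⊕ B} {p : G.Walk u v}
    {q : G.Walk v w} (hp : Directed F p) (hq : Directed F q) : Directed F (p.append q) := by
  intro d hd
  rw [SimpleGraph.Walk.darts_append, List.mem_append] at hd
  exact hd.elim (hp d) (hq d)

theorem Directed.concat {F : Finset (Sym2 (A ⊕ B))} {u v w : A ⊕ B} {p : G.Walk u v}
    (hp : Directed F p) (h : G.Adj v w) (ha : Arc F v w) : Directed F (p.concat h) := by
  rw [SimpleGraph.Walk.concat_eq_append]
  exact hp.append (by simp [ha])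

theorem Directed.mem_of_closed {F : Finset (Sym2 (A ⊕ B))} {S : Set (A ⊕ B)}
    (hS : ∀ u ∈ S, ∀ v, G.Adj u v → Arc F u v → v ∈ S) {u v : A ⊕ B} {P : G.Walk u v}
    (hd : Directed F P) (hu : u ∈ S) : v ∈ S := by
  induction P with
  | nil => exact hu
  | cons h p ih =>
    rw [directed_cons] at hd
    exact ih hd.2 (hS _ hu _ h hd.1)

theorem directed_iff_getVert (hG : G ≤ completeBipartiteGraph A B) (F : Finset (Sym2 (A ⊕ B)))
    {u v : A ⊕ B} (P : G.Walk u v) :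
    Directed F P ↔ ∀ i < P.length,
      (s(P.getVert i, P.getVert (i + 1)) ∈ F ↔ (Odd i ↔ u.isRight = true)) := by
  induction P with
  | nil => simp
  | @cons u v w h p ih =>
    rw [directed_cons, ih, SimpleGraph.Walk.length_cons, Nat.forall_lt_succ_left]
    refine and_congr ?_ ?_
    · rcases adj_cases hG h with ⟨a, y, rfl, rfl⟩ | ⟨a, y, rfl, rfl⟩ <;> simp [Arc]
    · refine forall₂_congr fun i _ => ?_
      rcases adj_cases hG h with ⟨a, y, rfl, rfl⟩ | ⟨a, y, rfl, rfl⟩ <;>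
        simp [Nat.odd_add_one]

theorem isAugmenting_iff (hG : G ≤ completeBipartiteGraph A B) {F : Finset (Sym2 (A ⊕ B))}
    {y : B} {a : A} (P : G.Walk (Sum.inr y) (Sum.inl a)) :
    IsAugmenting F P ↔ P.IsPath ∧ Directed F P := by
  rw [IsAugmenting, directed_iff_getVert hG]
  simp

/-! ### Degrees after an augmentation -/

variable [DecidableEq A] [DecidableEq B]

theorem arc_symmDiff {F S : Finset (Sym2 (A ⊕ B))} {u v : A ⊕ B} (h : s(u, v) ∉ S) :
    Arc (symmDiff F S) u v ↔ Arc F u v := by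
  rcases u with a | y <;> rcases v with a' | y' <;> simp_all [Arc, Finset.mem_symmDiff]

theorem fdeg_symmDiff_singleton (F : Finset (Sym2 (A ⊕ B))) (e : Sym2 (A ⊕ B)) (w : A ⊕ B) :
    (fdeg (symmDiff F {e}) w : ℤ) =
      fdeg F w + if w ∈ e then (if e ∈ F then -1 else 1) else 0 := by
  unfold fdeg
  by_cases he : e ∈ F
  · have h1 : symmDiff F {e} = F.erase e := by
      ext x; by_cases hx : x = e <;> simp [Finset.mem_symmDiff, hx, he]
    rw [h1, Finset.filter_erase]
    by_cases hw : w ∈ e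
    · rw [Finset.card_erase_of_mem (by simp [he, hw])]
      have : 0 < #{x ∈ F | w ∈ x} := Finset.card_pos.2 ⟨e, by simp [he, hw]⟩
      simp only [hw, he, if_true]
      omega
    · rw [Finset.erase_eq_of_notMem (by simp [hw])]
      simp [hw]
  · have h1 : symmDiff F {e} = insert e F := by
      ext x; by_cases hx : x = e <;> simp [Finset.mem_symmDiff, hx, he]
    rw [h1, Finset.filter_insert]
    by_cases hw : w ∈ e
    · simp [hw, he]
    · simp [hw]

theorem symmDiff_insert_of_notMem {α : Type*} [DecidableEq α] {F S : Finset α} {e : α}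
    (he : e ∉ S) : symmDiff F (insert e S) = symmDiff (symmDiff F S) {e} := by
  rw [symmDiff_assoc]
  congr 1
  ext x
  by_cases hx : x = e <;> simp [Finset.mem_symmDiff, hx, he]

/-- Flipping a directed trail changes the degrees at its two ends only: the contributions of
consecutive arcs cancel. -/
theorem fdeg_symmDiff_edges {F : Finset (Sym2 (A ⊕ B))} {u v : A ⊕ B} {P : G.Walk u v}
    (hP : P.IsTrail) (hd : Directed F P) (w : A ⊕ B) :
    (fdeg (symmDiff F P.edges.toFinset) w : ℤ) =
      fdeg F w + (if w = u then sgn u else 0) - (if w = v then sgn v else 0) := by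
  induction P with
  | nil => simp [← Finset.bot_eq_empty]
  | @cons u v x h p ih =>
    rw [SimpleGraph.Walk.isTrail_cons] at hP
    rw [directed_cons] at hd
    have he : s(u, v) ∉ p.edges.toFinset := by simpa using hP.2
    have hF : s(u, v) ∈ symmDiff F p.edges.toFinset ↔ s(u, v) ∈ F := by
      simp only [Finset.mem_symmDiff]; tauto
    rw [SimpleGraph.Walk.edges_cons, List.toFinset_cons, symmDiff_insert_of_notMem he,
      fdeg_symmDiff_singleton, ih hP.1 hd.2]
    simp only [hF]
    have hne : u ≠ v := h.ne
    have key : (if w ∈ s(u, v) then (if s(u, v) ∈ F then (-1 : ℤ) else 1) else 0) =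
        (if w = u then sgn u else 0) - (if w = v then sgn v else 0) := by
      have := hd.1
      rcases u with a | y <;> rcases v with a' | y' <;> simp only [Arc] at this <;>
        rcases w with c | z <;> simp [sgn, this] <;> split_ifs <;> rfl
    rw [key]; ring

/-! ### Augmentation preserves balance -/

/-- A directed walk from a vertex of `G_ℓ` stays in `G_ℓ`, as vertices of `B` are entered only
through edges of `F`. -/
theorem Directed.inStage {n : ℕ} {b : Fin n ≃ B} {l : Fin n} {F : Finset (Sym2 (A ⊕ B))}
    (hF : ∀ y, l < b.symm y → fdeg F (Sum.inr y) = 0) {u v : A ⊕ B} {P : G.Walk u v}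
    (hd : Directed F P) (hu : ∀ y, u = Sum.inr y → b.symm y ≤ l) : InStage b l P := by
  induction P with
  | nil => intro y hy; exact hu y (by simpa [eq_comm] using hy)
  | @cons u v w h p ih =>
    rw [directed_cons] at hd
    intro y hy
    rw [SimpleGraph.Walk.support_cons, List.mem_cons] at hy
    rcases hy with hy | hy
    · exact hu y hy.symm
    · refine ih hd.2 ?_ y hy
      rintro z rfl
      by_contra! hz
      have h0 := hF z hz
      rw [fdeg, Finset.card_eq_zero, Finset.filter_eq_empty_iff] at h0
      rcases u with a | y'
      · exact h0 hd.1 (by simp)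
      · exact hd.1

/-- A directed path whose end has least degree among all ends of directed walks is an admissible
choice; minimality over walks is the same as over paths. -/
theorem augments_of_directed (hG : G ≤ completeBipartiteGraph A B) {n : ℕ} {b : Fin n ≃ B}
    {l : Fin n} {F : Finset (Sym2 (A ⊕ B))}
    (hF : ∀ y, l < b.symm y → fdeg F (Sum.inr y) = 0) {a : A}
    {P : G.Walk (Sum.inr (b l)) (Sum.inl a)} (hP : P.IsPath) (hd : Directed F P)
    (hmin : ∀ (a' : A) (Q : G.Walk (Sum.inr (b l)) (Sum.inl a')),
      Directed F Q → fdeg F (Sum.inl a) ≤ fdeg F (Sum.inl a')) :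
    Augments G b l F (symmDiff F P.edges.toFinset) := by
  refine ⟨a, P, (isAugmenting_iff hG P).2 ⟨hP, hd⟩, hd.inStage hF ?_, ?_, rfl⟩
  · intro y hy
    obtain rfl : b l = y := by simpa using hy
    simp
  · intro a' Q hQ _
    exact hmin a' Q ((isAugmenting_iff hG Q).1 hQ).2

theorem exists_directed_path {F : Finset (Sym2 (A ⊕ B))} {u v : A ⊕ B} {Q : G.Walk u v}
    (hQ : Directed F Q) : ∃ P : G.Walk u v, P.IsPath ∧ Directed F P :=
  ⟨Q.bypass, Q.bypass_isPath, fun d hd => hQ d (Q.darts_bypass_subset_darts hd)⟩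

/-- For every level `k`, the vertices of `A` of degree above `k` are separated from those of degree
below `k` by a set that is closed under arcs. -/
def Balanced (G : SimpleGraph (A ⊕ B)) (F : Finset (Sym2 (A ⊕ B))) : Prop :=
  ∀ k : ℕ, ∃ S : Set (A ⊕ B), (∀ u ∈ S, ∀ v, G.Adj u v → Arc F u v → v ∈ S) ∧
    (∀ a, k < fdeg F (Sum.inl a) → Sum.inl a ∈ S) ∧
    ∀ a, Sum.inl a ∈ S → k ≤ fdeg F (Sum.inl a)

theorem balanced_empty : Balanced G ∅ :=
  fun _ => ⟨∅, by simp, by simp [fdeg], by simp⟩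

theorem Augments.fdeg_inr (hG : G ≤ completeBipartiteGraph A B) {n : ℕ} {b : Fin n ≃ B}
    {l : Fin n} {F F' : Finset (Sym2 (A ⊕ B))} (h : Augments G b l F F') (y : B) :
    fdeg F' (Sum.inr y) = fdeg F (Sum.inr y) + if y = b l then 1 else 0 := by
  obtain ⟨a, P, hP, -, -, rfl⟩ := h
  rw [isAugmenting_iff hG] at hP
  have := fdeg_symmDiff_edges hP.1.isTrail hP.2 (Sum.inr y)
  simp only [Sum.inr.injEq, sgn, reduceCtorEq, if_false] at this
  split_ifs at this ⊢ <;> omega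

theorem Augments.subset {n : ℕ} {b : Fin n ≃ B} {l : Fin n} {F F' : Finset (Sym2 (A ⊕ B))}
    (h : Augments G b l F F') (hF : (F : Set (Sym2 (A ⊕ B))) ⊆ G.edgeSet) :
    (F' : Set (Sym2 (A ⊕ B))) ⊆ G.edgeSet := by
  obtain ⟨a, P, -, -, -, rfl⟩ := h
  intro e he
  rw [Finset.mem_coe, Finset.mem_symmDiff] at he
  rcases he with he | he
  · exact hF he.1
  · exact P.edges_subset_edgeSet (by simpa using he.1)

theorem Augments.balanced (hG : G ≤ completeBipartiteGraph A B) {n : ℕ} {b : Fin n ≃ B}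
    {l : Fin n} {F F' : Finset (Sym2 (A ⊕ B))}
    (hF : ∀ y, l < b.symm y → fdeg F (Sum.inr y) = 0) (h : Augments G b l F F')
    (hB : Balanced G F) : Balanced G F' := by
  obtain ⟨a, P, hP, -, hmin, rfl⟩ := h
  rw [isAugmenting_iff hG] at hP
  have hdeg : ∀ c : A, fdeg (symmDiff F P.edges.toFinset) (Sum.inl c) =
      fdeg F (Sum.inl c) + if c = a then 1 else 0 := by
    intro c
    have := fdeg_symmDiff_edges hP.1.isTrail hP.2 (Sum.inl c)
    simp only [Sum.inl.injEq, sgn, reduceCtorEq, if_false] at this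
    split_ifs at this ⊢ <;> omega
  intro k
  obtain ⟨S, hS, hS1, hS2⟩ := hB k
  rcases lt_or_ge (fdeg F (Sum.inl a)) k with hk | hk
  -- A set for a level above the degree of `a` is never entered by `P`, so it stays closed.
  · refine ⟨S, ?_, ?_, ?_⟩
    · intro u hu v huv harc
      by_cases he : s(u, v) ∈ P.edges
      · have hu' := P.fst_mem_support_of_mem_edges he
        have hdrop : Directed F (P.dropUntil u hu') :=
          fun d hd => hP.2 d (P.darts_dropUntil_subset_darts hu' hd)
        have := hS2 a (hdrop.mem_of_closed hS hu)
        omega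
      · exact hS u hu v huv ((arc_symmDiff (by simpa using he)).1 harc)
    · intro c hc
      refine hS1 c ?_
      rw [hdeg] at hc
      split_ifs at hc with hca
      · subst hca; omega
      · omega
    · intro c hc
      have := hS2 c hc
      rw [hdeg]; omega
  -- For lower levels the vertices reachable from `b l` are added; they contain all of `P`.
  · refine ⟨S ∪ {v | ∃ Q : G.Walk (Sum.inr (b l)) v, Directed F Q}, ?_, ?_, ?_⟩
    · intro u hu v huv harc
      by_cases he : s(u, v) ∈ P.edges
      · have hv := P.snd_mem_support_of_mem_edges he
        exact Or.inr ⟨P.takeUntil v hv,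
          fun d hd => hP.2 d (P.darts_takeUntil_subset_darts hv hd)⟩
      · have harc := (arc_symmDiff (by simpa using he)).1 harc
        rcases hu with hu | ⟨Q, hQ⟩
        · exact Or.inl (hS u hu v huv harc)
        · exact Or.inr ⟨Q.concat huv, hQ.concat huv harc⟩
    · intro c hc
      rw [hdeg] at hc
      split_ifs at hc with hca
      · subst hca
        exact Or.inr ⟨P, hP.2⟩
      · exact Or.inl (hS1 c hc)
    · intro c hc
      rw [hdeg]
      rcases hc with hc | ⟨Q, hQ⟩
      · have := hS2 c hc; omega
      · obtain ⟨Q', hQ', hQd⟩ := exists_directed_path hQ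
        have := hmin c Q' ((isAugmenting_iff hG Q').2 ⟨hQ', hQd⟩) (hQd.inStage hF (by
          intro y hy
          obtain rfl : b l = y := by simpa using hy
          simp))
        omega

theorem exists_augments [Finite A] [Finite B] (hG : G ≤ completeBipartiteGraph A B) {n : ℕ}
    {b : Fin n ≃ B} {l : Fin n} {F : Finset (Sym2 (A ⊕ B))}
    (hF : ∀ y, l < b.symm y → fdeg F (Sum.inr y) = 0) {a : A}
    (ha : G.Adj (Sum.inr (b l)) (Sum.inl a)) (haF : s(Sum.inr (b l), Sum.inl a) ∉ F) :
    ∃ F', Augments G b l F F' := by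
  classical
  let R : Set A := {c | ∃ Q : G.Walk (Sum.inr (b l)) (Sum.inl c), Directed F Q}
  have hR : R.Nonempty := ⟨a, .cons ha .nil, by simpa [Arc] using haF⟩
  obtain ⟨c, ⟨Q, hQ⟩, hc⟩ := Set.exists_min_image R (fun c => fdeg F (Sum.inl c)) R.toFinite hR
  obtain ⟨P, hP, hd⟩ := exists_directed_path hQ
  exact ⟨_, augments_of_directed hG hF hP hd fun a' Q hQ => hc a' ⟨Q, hQ⟩⟩

theorem exists_edge_notMem (hG : G ≤ completeBipartiteGraph A B) {F H : Finset (Sym2 (A ⊕ B))}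
    (hH : (H : Set (Sym2 (A ⊕ B))) ⊆ G.edgeSet) {y : B}
    (h : fdeg F (Sum.inr y) < fdeg H (Sum.inr y)) :
    ∃ a, G.Adj (Sum.inr y) (Sum.inl a) ∧ s(Sum.inr y, Sum.inl a) ∉ F := by
  obtain ⟨e, he, he'⟩ := Finset.exists_mem_notMem_of_card_lt_card h
  rw [Finset.mem_filter] at he he'
  obtain ⟨v, rfl⟩ := Sym2.mem_iff_exists.1 he.2
  have hadj : G.Adj (Sum.inr y) v := hH he.1
  rcases adj_cases hG hadj with ⟨a, z, h1, h2⟩ | ⟨a, z, h1, rfl⟩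
  · simp at h1
  · exact ⟨a, hadj, fun hF => he' ⟨hF, he.2⟩⟩

/-! ### Balanced sets are lexicographically minimum -/

theorem exists_sum_tsub_lt_of_lex {L L' : List ℕ} (hlen : L.length = L'.length)
    (hL' : L'.Pairwise (· ≥ ·)) (h : L' < L) :
    ∃ k, (L'.map (· - k)).sum < (L.map (· - k)).sum := by
  induction L' generalizing L with
  | nil => cases L with
    | nil => simp at h
    | cons => simp at hlen
  | cons x L' ih =>
    cases L with
    | nil => simp at hlen
    | cons z L =>
      rw [List.pairwise_cons] at hL'
      rw [List.cons_lt_cons_iff] at h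
      rcases h with h | ⟨rfl, h⟩
      -- The threshold is the entry of the smaller list at the first difference.
      · refine ⟨x, ?_⟩
        have h0 : (L'.map (· - x)).sum = 0 := by
          rw [List.sum_eq_zero_iff]
          simp only [List.mem_map]
          rintro _ ⟨w, hw, rfl⟩
          have := hL'.1 w hw
          omega
        simp only [List.map_cons, List.sum_cons, h0]
        omega
      · obtain ⟨k, hk⟩ := ih (by simpa using hlen) hL'.2 h
        exact ⟨k, by simpa using hk⟩

theorem fdeg_inl_eq_card [Fintype B] (hG : G ≤ completeBipartiteGraph A B)
    {F : Finset (Sym2 (A ⊕ B))} (hF : (F : Set (Sym2 (A ⊕ B))) ⊆ G.edgeSet) (a : A) :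
    fdeg F (Sum.inl a) = #{y | s(Sum.inl a, Sum.inr y) ∈ F} := by
  unfold fdeg
  symm
  refine Finset.card_bij (fun y _ => s(Sum.inl a, Sum.inr y)) (by simp) (by simp) ?_
  intro e he
  rw [Finset.mem_filter] at he
  obtain ⟨v, rfl⟩ := Sym2.mem_iff_exists.1 he.2
  rcases adj_cases hG (hF he.1) with ⟨a', z, h1, rfl⟩ | ⟨a', z, h1, h2⟩
  · exact ⟨z, by simpa using he.1, rfl⟩
  · simp at h1

theorem fdeg_inr_eq_card [Fintype A] (hG : G ≤ completeBipartiteGraph A B)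
    {F : Finset (Sym2 (A ⊕ B))} (hF : (F : Set (Sym2 (A ⊕ B))) ⊆ G.edgeSet) (y : B) :
    fdeg F (Sum.inr y) = #{a | s(Sum.inl a, Sum.inr y) ∈ F} := by
  unfold fdeg
  symm
  refine Finset.card_bij (fun a _ => s(Sum.inl a, Sum.inr y)) (by simp) (by simp) ?_
  intro e he
  rw [Finset.mem_filter] at he
  obtain ⟨v, rfl⟩ := Sym2.mem_iff_exists.1 he.2
  rcases adj_cases hG (hF he.1) with ⟨a', z, h1, rfl⟩ | ⟨a', z, h1, rfl⟩
  · simp at h1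
  · exact ⟨a', by simpa [Sym2.eq_swap] using he.1, Sym2.eq_swap⟩

/-- A closed set `S` receives edges of `F` from `B ∩ S` only, and from a vertex of `B ∩ S` all
edges leaving `S` lie in `F` already; so no other set with the same needs puts fewer edges into `S`. -/
theorem sum_fdeg_le_of_closed [Fintype A] [Fintype B] (hG : G ≤ completeBipartiteGraph A B)
    {F F' : Finset (Sym2 (A ⊕ B))} (hF : (F : Set (Sym2 (A ⊕ B))) ⊆ G.edgeSet)
    (hF' : (F' : Set (Sym2 (A ⊕ B))) ⊆ G.edgeSet)
    (hle : ∀ y, fdeg F (Sum.inr y) ≤ fdeg F' (Sum.inr y)) {S : Set (A ⊕ B)}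
    (hS : ∀ u ∈ S, ∀ v, G.Adj u v → Arc F u v → v ∈ S) {X : Finset A}
    (hX : ∀ a, a ∈ X ↔ Sum.inl a ∈ S) :
    ∑ a ∈ X, fdeg F (Sum.inl a) ≤ ∑ a ∈ X, fdeg F' (Sum.inl a) := by
  have count : ∀ H : Finset (Sym2 (A ⊕ B)), (H : Set (Sym2 (A ⊕ B))) ⊆ G.edgeSet →
      ∑ a ∈ X, fdeg H (Sum.inl a) = ∑ y, #{a ∈ X | s(Sum.inl a, Sum.inr y) ∈ H} := by
    intro H hH
    simp_rw [fdeg_inl_eq_card hG hH]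
    exact Finset.sum_card_bipartiteAbove_eq_sum_card_bipartiteBelow
      (fun a y => s(Sum.inl a, Sum.inr y) ∈ H)
  rw [count F hF, count F' hF']
  refine Finset.sum_le_sum fun y _ => ?_
  by_cases hy : Sum.inr y ∈ S
  · have split : ∀ H : Finset (Sym2 (A ⊕ B)), (H : Set (Sym2 (A ⊕ B))) ⊆ G.edgeSet →
        fdeg H (Sum.inr y) = #{a ∈ X | s(Sum.inl a, Sum.inr y) ∈ H} +
          #{a ∈ Xᶜ | s(Sum.inl a, Sum.inr y) ∈ H} := by
      intro H hH
      rw [fdeg_inr_eq_card hG hH, ← Finset.card_union_of_disjoint, ← Finset.filter_union,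
        Finset.union_compl]
      exact Finset.disjoint_filter_filter disjoint_compl_right
    have hsub : #{a ∈ Xᶜ | s(Sum.inl a, Sum.inr y) ∈ F'} ≤
        #{a ∈ Xᶜ | s(Sum.inl a, Sum.inr y) ∈ F} := by
      refine Finset.card_le_card fun a ha => ?_
      rw [Finset.mem_filter, Finset.mem_compl] at ha ⊢
      refine ⟨ha.1, ?_⟩
      by_contra hn
      have hadj : G.Adj (Sum.inl a) (Sum.inr y) := hF' ha.2
      exact ha.1 ((hX a).2 (hS _ hy _ hadj.symm (by simpa [Arc, Sym2.eq_swap] using hn)))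
    have := hle y
    rw [split F hF, split F' hF'] at this
    omega
  · rw [Finset.card_eq_zero.2]
    · exact Nat.zero_le _
    · refine Finset.filter_eq_empty_iff.2 fun a ha haF => hy ?_
      exact hS _ ((hX a).1 ha) _ (hF haF) haF

theorem Balanced.sum_tsub_le [Fintype A] [Fintype B] (hG : G ≤ completeBipartiteGraph A B)
    {F F' : Finset (Sym2 (A ⊕ B))} (hF : (F : Set (Sym2 (A ⊕ B))) ⊆ G.edgeSet)
    (hF' : (F' : Set (Sym2 (A ⊕ B))) ⊆ G.edgeSet)
    (hle : ∀ y, fdeg F (Sum.inr y) ≤ fdeg F' (Sum.inr y)) (hB : Balanced G F) (k : ℕ) :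
    ∑ a, (fdeg F (Sum.inl a) - k) ≤ ∑ a, (fdeg F' (Sum.inl a) - k) := by
  classical
  obtain ⟨S, hS, hS1, hS2⟩ := hB k
  let X : Finset A := {a | Sum.inl a ∈ S}
  have hX : ∀ a, a ∈ X ↔ Sum.inl a ∈ S := by simp [X]
  have h1 := sum_fdeg_le_of_closed hG hF hF' hle hS hX
  have h2 : ∑ a, (fdeg F (Sum.inl a) - k) = ∑ a ∈ X, (fdeg F (Sum.inl a) - k) := by
    symm
    refine Finset.sum_subset (Finset.subset_univ _) fun a _ ha => ?_
    have : ¬ k < fdeg F (Sum.inl a) := fun h => ha ((hX a).2 (hS1 a h))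
    omega
  have h3 : ∑ a ∈ X, (fdeg F (Sum.inl a) - k) + ∑ a ∈ X, k = ∑ a ∈ X, fdeg F (Sum.inl a) := by
    rw [← Finset.sum_add_distrib]
    refine Finset.sum_congr rfl fun a ha => ?_
    have := hS2 a ((hX a).1 ha)
    omega
  have h4 : ∑ a ∈ X, fdeg F' (Sum.inl a) ≤ ∑ a ∈ X, (fdeg F' (Sum.inl a) - k) + ∑ a ∈ X, k := by
    rw [← Finset.sum_add_distrib]
    exact Finset.sum_le_sum fun a _ => by omega
  have h5 : ∑ a ∈ X, (fdeg F' (Sum.inl a) - k) ≤ ∑ a, (fdeg F' (Sum.inl a) - k) :=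
    Finset.sum_le_sum_of_subset (Finset.subset_univ _)
  omega

theorem sum_degSeq (F : Finset (Sym2 (A ⊕ B))) (X : Finset A) (k : ℕ) :
    ((degSeq F X).map (· - k)).sum = ∑ a ∈ X, (fdeg F (Sum.inl a) - k) := by
  rw [← Multiset.sum_coe, ← Multiset.map_coe, degSeq, Multiset.sort_eq, Multiset.map_map]
  rfl

theorem sum_nbhd_univ [Fintype A] [Fintype B] (hG : G ≤ completeBipartiteGraph A B)
    {F : Finset (Sym2 (A ⊕ B))} (hF : (F : Set (Sym2 (A ⊕ B))) ⊆ G.edgeSet) (k : ℕ) :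
    ∑ a ∈ nbhd G univ, (fdeg F (Sum.inl a) - k) = ∑ a, (fdeg F (Sum.inl a) - k) := by
  refine Finset.sum_subset (Finset.subset_univ _) fun a _ ha => ?_
  have : fdeg F (Sum.inl a) = 0 := by
    rw [fdeg_inl_eq_card hG hF, Finset.card_eq_zero, Finset.filter_eq_empty_iff]
    intro y _ hy
    exact ha (by simpa [nbhd] using ⟨y, hF hy⟩)
  omega

theorem Balanced.isMinimum [Fintype A] [Fintype B] (hG : G ≤ completeBipartiteGraph A B)
    {g : B → ℕ} {F : Finset (Sym2 (A ⊕ B))} (hF : (F : Set (Sym2 (A ⊕ B))) ⊆ G.edgeSet)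
    (hg : ∀ y, fdeg F (Sum.inr y) = g y) (hB : Balanced G F) : IsMinimum G g univ F := by
  refine ⟨⟨hF, fun y _ => (hg y).ge⟩, fun F' hF' hlex => ?_⟩
  obtain ⟨k, hk⟩ := exists_sum_tsub_lt_of_lex (by simp [degSeq]) (by simp [degSeq]) hlex
  rw [sum_degSeq, sum_degSeq, sum_nbhd_univ hG hF, sum_nbhd_univ hG hF'.1] at hk
  have := hB.sum_tsub_le hG hF hF'.1 (fun y => (hg y).le.trans (hF'.2 y (mem_univ y))) k
  omega

end Combinatorics

/-! ### The schedule and the invariant of an execution -/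

section Executions

variable {A B : Type*} {G : SimpleGraph (A ⊕ B)} {n : ℕ}

theorem length_schedule [Fintype B] (b : Fin n ≃ B) (g : B → ℕ) :
    (schedule b g).length = ∑ y, g y := by
  rw [schedule, List.length_flatMap, ← Equiv.sum_comp b g, ← List.sum_ofFn, List.ofFn_eq_map]
  simp

theorem count_schedule (b : Fin n ≃ B) (g : B → ℕ) (l : Fin n) :
    (schedule b g).count l = g (b l) := by
  rw [schedule, List.count_flatMap]
  have : (List.count l ∘ fun l => List.replicate (g (b l)) l) =
      fun l' => if l' = l then g (b l') else 0 := by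
    ext l'; simp [List.count_replicate]
  rw [this, ← List.ofFn_eq_map, List.sum_ofFn]
  simp

theorem sorted_schedule (b : Fin n ≃ B) (g : B → ℕ) : (schedule b g).Pairwise (· ≤ ·) := by
  rw [schedule, List.pairwise_flatMap]
  refine ⟨fun l _ => List.pairwise_replicate.2 (Or.inr le_rfl), ?_⟩
  refine (List.pairwise_lt_finRange n).imp ?_
  intro l l' h x hx y hy
  rw [List.mem_replicate] at hx hy
  rw [hx.2, hy.2]
  exact h.le

/-- When `b l` is scheduled, its need is not yet met. -/
theorem count_take_schedule_lt {b : Fin n ≃ B} {g : B → ℕ} {i : ℕ} {l : Fin n}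
    (h : (schedule b g)[i]? = some l) : ((schedule b g).take i).count l < g (b l) := by
  rw [← count_schedule b g l]
  have h1 : (schedule b g).take (i + 1) = (schedule b g).take i ++ [l] := by
    rw [List.take_add_one, h]; rfl
  have h2 : ((schedule b g).take (i + 1)).count l ≤ (schedule b g).count l :=
    (List.take_sublist _ _).count_le _
  rw [h1, List.count_append] at h2
  simp at h2
  omega

theorem count_take_schedule_eq_zero {b : Fin n ≃ B} {g : B → ℕ} {i : ℕ} {l l' : Fin n}
    (h : (schedule b g)[i]? = some l) (hl : l < l') : ((schedule b g).take i).count l' = 0 := by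
  rw [List.count_eq_zero]
  intro hmem
  obtain ⟨hi, hil⟩ := List.getElem?_eq_some_iff.1 h
  obtain ⟨j, hj, hjl⟩ := List.mem_iff_getElem.1 hmem
  rw [List.length_take] at hj
  have := List.pairwise_iff_getElem.1 (sorted_schedule b g) j i (by omega) hi (by omega)
  rw [List.getElem_take] at hjl
  rw [hjl, hil] at this
  exact absurd hl (not_lt.2 this)

variable [DecidableEq A] [DecidableEq B]

/-- The invariant of an execution after `i` passes: the degrees on `B` are the numbers of passes
spent on the vertices so far. -/
structure Reached (G : SimpleGraph (A ⊕ B)) (b : Fin n ≃ B) (g : B → ℕ) (i : ℕ)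
    (F : Finset (Sym2 (A ⊕ B))) : Prop where
  subset : (F : Set (Sym2 (A ⊕ B))) ⊆ G.edgeSet
  balanced : Balanced G F
  fdeg_eq : ∀ l, fdeg F (Sum.inr (b l)) = ((schedule b g).take i).count l

theorem reached_zero (b : Fin n ≃ B) (g : B → ℕ) : Reached G b g 0 ∅ :=
  ⟨by simp, balanced_empty, by simp [fdeg]⟩

theorem Reached.fdeg_later {b : Fin n ≃ B} {g : B → ℕ} {i : ℕ} {F : Finset (Sym2 (A ⊕ B))}
    (h : Reached G b g i F) {l : Fin n} (hl : (schedule b g)[i]? = some l) (y : B)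
    (hy : l < b.symm y) : fdeg F (Sum.inr y) = 0 := by
  have := h.fdeg_eq (b.symm y)
  rwa [Equiv.apply_symm_apply, count_take_schedule_eq_zero hl hy] at this

theorem Reached.pass (hG : G ≤ completeBipartiteGraph A B) {b : Fin n ≃ B} {g : B → ℕ} {i : ℕ}
    {F F' : Finset (Sym2 (A ⊕ B))} (h : Reached G b g i F) (hp : Pass G b g i F F') :
    Reached G b g (i + 1) F' := by
  obtain ⟨l, hl, haug⟩ := hp
  refine ⟨haug.subset h.subset, haug.balanced hG (h.fdeg_later hl) h.balanced, fun l' => ?_⟩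
  rw [haug.fdeg_inr hG, h.fdeg_eq, List.take_add_one, hl, List.count_append]
  by_cases hll : l' = l
  · simp [hll]
  · simp [hll, Ne.symm hll]

theorem IsExecution.reached (hG : G ≤ completeBipartiteGraph A B) {b : Fin n ≃ B} {g : B → ℕ}
    {k : ℕ} {F : ℕ → Finset (Sym2 (A ⊕ B))} (h : IsExecution G b g k F) :
    ∀ i ≤ k, Reached G b g i (F i) := by
  intro i
  induction i with
  | zero => intro _; rw [h.1]; exact reached_zero b g
  | succ i ih => intro hi; exact (ih (by omega)).pass hG (h.2 i (by omega))

theorem Reached.exists_edge (hG : G ≤ completeBipartiteGraph A B) [Fintype B] {b : Fin n ≃ B}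
    {g : B → ℕ} (hq : ∃ H, IsQuasiMatching G g univ H) {i : ℕ} {F : Finset (Sym2 (A ⊕ B))}
    (h : Reached G b g i F) {l : Fin n} (hl : (schedule b g)[i]? = some l) :
    ∃ a, G.Adj (Sum.inr (b l)) (Sum.inl a) ∧ s(Sum.inr (b l), Sum.inl a) ∉ F := by
  obtain ⟨H, hH⟩ := hq
  refine exists_edge_notMem hG hH.1 ?_
  rw [h.fdeg_eq]
  exact (count_take_schedule_lt hl).trans_le (hH.2 _ (mem_univ _))

theorem IsExecution.exists_pass [Fintype A] [Fintype B] (hG : G ≤ completeBipartiteGraph A B)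
    {b : Fin n ≃ B} {g : B → ℕ} (hq : ∃ H, IsQuasiMatching G g univ H) {k : ℕ}
    {F : ℕ → Finset (Sym2 (A ⊕ B))} (hk : k < ∑ y, g y) (h : IsExecution G b g k F) :
    ∃ F', Pass G b g k (F k) F' := by
  have hR := h.reached hG k le_rfl
  have hl : (schedule b g)[k]? = some ((schedule b g)[k]'(by rwa [length_schedule])) :=
    List.getElem?_eq_getElem _
  obtain ⟨a, ha, haF⟩ := hR.exists_edge hG hq hl
  obtain ⟨F', hF'⟩ := exists_augments hG (hR.fdeg_later hl) ha haF
  exact ⟨F', _, hl, hF'⟩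

theorem IsExecution.isMinimum [Fintype A] [Fintype B] (hG : G ≤ completeBipartiteGraph A B)
    {b : Fin n ≃ B} {g : B → ℕ} {F : ℕ → Finset (Sym2 (A ⊕ B))}
    (h : IsExecution G b g (∑ y, g y) F) : IsMinimum G g univ (F (∑ y, g y)) := by
  have hR := h.reached hG _ le_rfl
  refine hR.balanced.isMinimum hG hR.subset fun y => ?_
  have := hR.fdeg_eq (b.symm y)
  rwa [List.take_of_length_le (length_schedule b g).le, count_schedule,
    Equiv.apply_symm_apply] at this

end Executions

/-! ### Program logic with a step count -/

section Machine

/-- Total correctness with a step count: started on the store `s` at time `t`, the code `c` ends at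
a time and in a store that satisfy `Q`, whatever code follows it. -/
def WP (c : List Instr) (s : Store) (t : ℕ) (Q : ℕ → Store → Prop) : Prop :=
  ∃ s' d, (∀ r, step^[d] (c ++ r, s) = (r, s')) ∧ Q (t + d) s'

theorem iterate_step_nil (d : ℕ) (s : Store) : step^[d] ([], s) = ([], s) :=
  Function.iterate_fixed rfl d

@[simp] theorem wp_nil {s : Store} {t : ℕ} {Q : ℕ → Store → Prop} : WP [] s t Q ↔ Q t s := by
  constructor
  · rintro ⟨s', d, h, hQ⟩
    rcases d with _ | d
    · obtain rfl : s = s' := by simpa using h []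
      simpa using hQ
    · have := h [.const 0 0]
      rw [List.nil_append, Function.iterate_succ_apply, step, iterate_step_nil] at this
      simp at this
  · exact fun h => ⟨s, 0, by simp, by simpa using h⟩

theorem wp_cons_iff {i : Instr} {r r' : List Instr} {s s' : Store}
    (h : ∀ q, step (i :: r ++ q, s) = (r' ++ q, s')) {t : ℕ} {Q : ℕ → Store → Prop} :
    WP (i :: r) s t Q ↔ WP r' s' (t + 1) Q := by
  constructor
  · rintro ⟨s₁, d, hd, hQ⟩
    rcases d with _ | d
    · have := hd []
      simp at this
    · refine ⟨s₁, d, fun q => ?_, by rwa [add_assoc, add_comm 1]⟩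
      rw [← h, ← Function.iterate_succ_apply]
      exact hd q
  · rintro ⟨s₁, d, hd, hQ⟩
    refine ⟨s₁, d + 1, fun q => ?_, by rwa [add_comm d, ← add_assoc]⟩
    rw [Function.iterate_succ_apply, h]
    exact hd q

variable {s : Store} {t : ℕ} {Q : ℕ → Store → Prop} {r : List Instr}

@[simp] theorem wp_const {x k : ℕ} :
    WP (.const x k :: r) s t Q ↔ WP r (s.setReg x k) (t + 1) Q :=
  wp_cons_iff fun _ => rfl

@[simp] theorem wp_copy {x y : ℕ} :
    WP (.copy x y :: r) s t Q ↔ WP r (s.setReg x (s.reg y)) (t + 1) Q :=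
  wp_cons_iff fun _ => rfl

@[simp] theorem wp_succ {x y : ℕ} :
    WP (.succ x y :: r) s t Q ↔ WP r (s.setReg x (s.reg y + 1)) (t + 1) Q :=
  wp_cons_iff fun _ => rfl

@[simp] theorem wp_pred {x y : ℕ} :
    WP (.pred x y :: r) s t Q ↔ WP r (s.setReg x (s.reg y - 1)) (t + 1) Q :=
  wp_cons_iff fun _ => rfl

@[simp] theorem wp_load {x u y : ℕ} :
    WP (.load x u y :: r) s t Q ↔ WP r (s.setReg x (s.arr u (s.reg y))) (t + 1) Q :=
  wp_cons_iff fun _ => rfl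

@[simp] theorem wp_store {u x y : ℕ} :
    WP (.store u x y :: r) s t Q ↔ WP r (s.setArr u (s.reg x) (s.reg y)) (t + 1) Q :=
  wp_cons_iff fun _ => rfl

@[simp] theorem wp_ifThenElse {c : Test} {p q : List Instr} :
    WP (.ifThenElse c p q :: r) s t Q ↔
      if c.eval s then WP (p ++ r) s (t + 1) Q else WP (q ++ r) s (t + 1) Q := by
  rw [← apply_ite (fun p => WP p s (t + 1) Q)]
  refine wp_cons_iff fun _ => ?_
  split_ifs <;> simp_all [step]

theorem WP.mono {c : List Instr} {Q' : ℕ → Store → Prop} (h : WP c s t Q)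
    (hQ : ∀ t' s', Q t' s' → Q' t' s') : WP c s t Q' := by
  obtain ⟨s', d, hd, h⟩ := h
  exact ⟨s', d, hd, hQ _ _ h⟩

theorem WP.append {c : List Instr} (h : WP c s t fun t' s' => WP r s' t' Q) :
    WP (c ++ r) s t Q := by
  obtain ⟨s₁, d, hd, s₂, d', hd', h⟩ := h
  refine ⟨s₂, d' + d, fun q => ?_, by rwa [add_comm d', ← add_assoc]⟩
  rw [List.append_assoc, Function.iterate_add_apply, hd, hd']

/-- The loop rule. The invariant speaks about the time and bounds it by `N`; as every test takes a
step, this bound also gives termination. -/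
theorem wp_loop {c : Test} {p : List Instr} (N : ℕ) (I : ℕ → Store → Prop) (h0 : I t s)
    (hN : ∀ t s, I t s → t ≤ N)
    (hbody : ∀ t s, I t s → c.eval s = true → WP p s (t + 1) I)
    (hexit : ∀ t s, I t s → c.eval s = false → Q (t + 1) s) :
    WP [.loop c p] s t Q := by
  induction hk : N + 1 - t using Nat.strong_induction_on generalizing t s with
  | _ k ih =>
    rcases hc : c.eval s with _ | _
    · exact ⟨s, 1, fun q => by simp [step, hc], hexit t s h0 hc⟩
    · obtain ⟨s₁, d, hd, hI⟩ := hbody t s h0 hc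
      have ht := hN t s h0
      obtain ⟨s₂, d', hd', hQ⟩ := ih (N + 1 - (t + 1 + d)) (by omega) hI rfl
      refine ⟨s₂, d' + (d + 1), fun q => ?_, ?_⟩
      · have h1 : step ([.loop c p] ++ q, s) = (p ++ ([.loop c p] ++ q), s) := by
          simp [step, hc]
        rw [Function.iterate_add_apply, Function.iterate_succ_apply, h1, hd, hd']
      · rwa [show t + (d' + (d + 1)) = t + 1 + d + d' by ring]

@[simp] theorem setReg_reg (x v y : ℕ) :
    (s.setReg x v).reg y = if y = x then v else s.reg y := by
  simp [Store.setReg, Function.update_apply]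

@[simp] theorem setReg_arr (x v : ℕ) : (s.setReg x v).arr = s.arr := rfl

@[simp] theorem setArr_reg (u i v : ℕ) : (s.setArr u i v).reg = s.reg := rfl

@[simp] theorem setArr_arr (u i v u' : ℕ) :
    (s.setArr u i v).arr u' = if u' = u then Function.update (s.arr u) i v else s.arr u' := by
  simp [Store.setArr, Function.update_apply]

attribute [simp] Test.eval

/-- The stores agree outside the registers `X` and the arrays `U`. -/
structure Frame (X U : Finset ℕ) (s s' : Store) : Prop where
  reg : ∀ x, x ∉ X → s'.reg x = s.reg x
  arr : ∀ u, u ∉ U → s'.arr u = s.arr u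

theorem Frame.refl (X U : Finset ℕ) (s : Store) : Frame X U s s := ⟨fun _ _ => rfl, fun _ _ => rfl⟩

theorem Frame.trans {X U X' U' : Finset ℕ} {s s' s'' : Store} (h : Frame X U s s')
    (h' : Frame X' U' s' s'') (hX : X' ⊆ X) (hU : U' ⊆ U) : Frame X U s s'' :=
  ⟨fun x hx => (h'.reg x fun h => hx (hX h)).trans (h.reg x hx),
    fun u hu => (h'.arr u fun h => hu (hU h)).trans (h.arr u hu)⟩

theorem Frame.setReg {X U : Finset ℕ} {s s' : Store} (h : Frame X U s s') {x : ℕ} (hx : x ∈ X)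
    (v : ℕ) : Frame X U s (s'.setReg x v) :=
  ⟨fun y hy => by rw [setReg_reg, if_neg (by rintro rfl; exact hy hx), h.reg y hy], h.arr⟩

theorem Frame.setArr {X U : Finset ℕ} {s s' : Store} (h : Frame X U s s') {u : ℕ} (hu : u ∈ U)
    (i v : ℕ) : Frame X U s (s'.setArr u i v) :=
  ⟨h.reg, fun y hy => by rw [setArr_arr, if_neg (by rintro rfl; exact hy hu), h.arr y hy]⟩

end Machine

/-! ### Linked lists and the state of a graph search -/

section Lists

/-- `LinkedList nx x L`: the pointer `x` leads, along the successors `nx`, through the list `L`.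
The pointer `0` ends a list, and `k + 1` points to the cell `k`. -/
inductive LinkedList (nx : ℕ → ℕ) : ℕ → List ℕ → Prop
  | nil : LinkedList nx 0 []
  | cons {k : ℕ} {L : List ℕ} (h : LinkedList nx (nx k) L) : LinkedList nx (k + 1) (k :: L)

theorem LinkedList.congr {nx nx' : ℕ → ℕ} {x : ℕ} {L : List ℕ} (h : LinkedList nx x L)
    (h' : ∀ k ∈ L, nx' k = nx k) : LinkedList nx' x L := by
  induction h with
  | nil => exact .nil
  | @cons k L h ih =>
    refine .cons ?_
    rw [h' k (by simp)]
    exact ih fun j hj => h' j (by simp [hj])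

theorem LinkedList.of_succ {nx : ℕ → ℕ} {k : ℕ} {L : List ℕ} (h : LinkedList nx (k + 1) L) :
    ∃ L', L = k :: L' ∧ LinkedList nx (nx k) L' := by
  cases h with
  | cons h => exact ⟨_, rfl, h⟩

theorem LinkedList.of_zero {nx : ℕ → ℕ} {L : List ℕ} (h : LinkedList nx 0 L) : L = [] := by
  cases h; rfl

/-- The indices below `k` of the arcs with tail `v`, in decreasing order. -/
def outList (tl : ℕ → ℕ) : ℕ → ℕ → List ℕ
  | 0, _ => []
  | k + 1, v => if tl k = v then k :: outList tl k v else outList tl k v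

theorem mem_outList {tl : ℕ → ℕ} {k v x : ℕ} : x ∈ outList tl k v ↔ x < k ∧ tl x = v := by
  induction k with
  | zero => simp [outList]
  | succ k ih =>
    rw [outList]
    split_ifs with h
    · rw [List.mem_cons, ih]
      constructor
      · rintro (rfl | h') <;> [exact ⟨by omega, h⟩; exact ⟨by omega, h'.2⟩]
      · rintro ⟨h1, h2⟩
        rcases Nat.lt_succ_iff_lt_or_eq.1 h1 with h1 | rfl
        · exact Or.inr ⟨h1, h2⟩
        · exact Or.inl rfl
    · rw [ih]
      constructor
      · rintro h'; exact ⟨by omega, h'.2⟩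
      · rintro ⟨h1, h2⟩
        rcases Nat.lt_succ_iff_lt_or_eq.1 h1 with h1 | rfl
        · exact ⟨h1, h2⟩
        · exact absurd h2 h

theorem length_outList (tl : ℕ → ℕ) (k v : ℕ) :
    (outList tl k v).length = #{x ∈ range k | tl x = v} := by
  induction k with
  | zero => simp [outList]
  | succ k ih =>
    rw [outList, range_add_one, filter_insert]
    split_ifs with h
    · rw [card_insert_of_notMem (by simp), List.length_cons, ih]
    · exact ih

variable (m : ℕ) (tl hd : ℕ → ℕ) (src : ℕ)

/-- `ArcPath m tl hd src L v`: read backwards, `L` lists the arcs (with indices below `m`) of a path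
from `src` to `v` that repeats no vertex. -/
inductive ArcPath : List ℕ → ℕ → Prop
  | nil : ArcPath [] src
  | cons {k : ℕ} {L : List ℕ} (h : ArcPath L (tl k)) (hk : k < m) (hsrc : hd k ≠ src)
      (hL : ∀ x ∈ L, hd x ≠ hd k) : ArcPath (k :: L) (hd k)

/-- The state of a search from `src`: `que` holds at the positions below `q` the arcs by which the
marked vertices other than `src` were first reached, and the pointers `par` trace each of them back
to `src` through marked vertices. Marks matter only at heads of arcs; other cells hold stale values. -/
structure SearchState (vis que par : ℕ → ℕ) (q : ℕ) : Prop where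
  vis_iff : ∀ k < m, vis (hd k) ≠ 0 ↔ hd k = src ∨ ∃ j < q, hd (que j) = hd k
  que_lt : ∀ j < q, que j < m
  que_ne : ∀ i j, i < j → j < q → hd (que i) ≠ hd (que j)
  path : ∀ j < q, ∃ L, LinkedList par (que j + 1) L ∧ ArcPath m tl hd src L (hd (que j)) ∧
    ∀ x ∈ L, ∃ i < q, hd (que i) = hd x

variable {m tl hd src}

theorem SearchState.le {vis que par : ℕ → ℕ} {q : ℕ} (h : SearchState m tl hd src vis que par q) :
    q ≤ m := by
  have := Finset.card_le_card_of_injOn (s := range q) (t := range m) que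
    (fun j hj => by simpa using h.que_lt j (by simpa using hj)) (by
      intro i hi j hj hij
      simp only [coe_range, Set.mem_Iio] at hi hj
      rcases lt_trichotomy i j with h' | h' | h'
      · exact absurd (congrArg hd hij) (h.que_ne i j h' hj)
      · exact h'
      · exact absurd (congrArg hd hij.symm) (h.que_ne j i h' hi))
  simpa using this

/-- Reaching an unmarked vertex preserves the state. The new path repeats no vertex because all
vertices of the old one are marked. -/
theorem SearchState.visit {vis que par : ℕ → ℕ} {q : ℕ}
    (h : SearchState m tl hd src vis que par q) {k cur : ℕ} (hk : k < m) (hvis : vis (hd k) = 0)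
    {L : List ℕ} (hL : LinkedList par cur L) (hp : ArcPath m tl hd src L (tl k))
    (hLq : ∀ x ∈ L, ∃ i < q, hd (que i) = hd x) :
    SearchState m tl hd src (Function.update vis (hd k) 1) (Function.update que q k)
      (Function.update par k cur) (q + 1) := by
  have hnew : ¬ (hd k = src ∨ ∃ j < q, hd (que j) = hd k) := fun h' => (h.vis_iff k hk).2 h' hvis
  push Not at hnew
  have hque : ∀ j < q, Function.update que q k j = que j := fun j hj =>
    Function.update_of_ne hj.ne _ _
  have hLk : ∀ x ∈ L, hd x ≠ hd k := by
    intro x hx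
    obtain ⟨i, hi, hix⟩ := hLq x hx
    exact hix ▸ hnew.2 i hi
  refine ⟨?_, ?_, ?_, ?_⟩
  · intro x hx
    rw [Function.update_apply, Nat.exists_lt_succ_right, Function.update_self]
    have : (∃ j < q, hd (Function.update que q k j) = hd x) ↔ ∃ j < q, hd (que j) = hd x :=
      exists_congr fun j => and_congr_right fun hj => by rw [hque j hj]
    rw [this]
    split_ifs with hxk
    · simp [hxk]
    · rw [h.vis_iff x hx]
      simp [Ne.symm hxk]
  · rw [Nat.forall_lt_succ_right, Function.update_self]
    exact ⟨fun j hj => by rw [hque j hj]; exact h.que_lt j hj, hk⟩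
  · intro i j hij hj
    rw [hque i (by omega)]
    rcases Nat.lt_succ_iff_lt_or_eq.1 hj with hj | rfl
    · rw [hque j hj]; exact h.que_ne i j hij hj
    · rw [Function.update_self]; exact hnew.2 i hij
  · have hpar : ∀ L' : List ℕ, (∀ x ∈ L', hd x ≠ hd k) → ∀ x ∈ L', Function.update par k cur x = par x :=
      fun L' h' x hx => Function.update_of_ne (fun hxk => h' x hx (congrArg hd hxk)) _ _
    have hold : ∀ L' : List ℕ, (∀ x ∈ L', ∃ i < q, hd (que i) = hd x) →
        ∀ x ∈ L', ∃ i < q + 1, hd (Function.update que q k i) = hd x := by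
      intro L' h' x hx
      obtain ⟨i, hi, hix⟩ := h' x hx
      exact ⟨i, by omega, by rwa [hque i hi]⟩
    rw [Nat.forall_lt_succ_right, Function.update_self]
    constructor
    · intro j hj
      rw [hque j hj]
      obtain ⟨L', h1, h2, h3⟩ := h.path j hj
      refine ⟨L', h1.congr (hpar L' ?_), h2, hold L' h3⟩
      intro x hx
      obtain ⟨i, hi, hix⟩ := h3 x hx
      exact hix ▸ hnew.2 i hi
    · refine ⟨k :: L, .cons ?_, .cons hp hk hnew.1 hLk, ?_⟩
      · rw [Function.update_self]
        exact hL.congr (hpar L hLk)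
      · rw [List.forall_mem_cons]
        exact ⟨⟨q, by omega, by rw [Function.update_self]⟩, hold L hLq⟩

theorem SearchState.linkedList_update {vis que par : ℕ → ℕ} {q : ℕ}
    (h : SearchState m tl hd src vis que par q) {k cur x : ℕ} (hk : k < m)
    (hvis : vis (hd k) = 0) {L : List ℕ} (hL : LinkedList par x L)
    (hLq : ∀ x ∈ L, ∃ i < q, hd (que i) = hd x) :
    LinkedList (Function.update par k cur) x L := by
  refine hL.congr fun y hy => Function.update_of_ne ?_ _ _
  rintro rfl
  exact (h.vis_iff y hk).2 (Or.inr (hLq y hy)) hvis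

end Lists

/-! ### The program -/

/-- Registers `0, …, 3` hold `p`, `n`, `m` and the index `l` of the current vertex of `B`, register
`4` the number of finished passes for it, register `5` always `0`. This part numbers the vertices
of `A`: array `4` receives at `a` the value `n + k` for the last edge `k` at `a`. -/
def labelCode : List Instr :=
  [.const 6 0, .copy 7 1,
    .loop (.lt 6 2) [.load 8 1 6, .store 4 8 7, .succ 6 6, .succ 7 7]]

/-- Stores tails and heads of the arcs in the arrays `5` and `6`, and resets list heads (array `7`),
out-degrees (array `9`) and marks (array `10`) at the ends of all edges. -/
def orientCode : List Instr :=
  [.const 6 0,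
    .loop (.lt 6 2)
      [.load 7 1 6, .load 7 4 7, .load 8 2 6, .load 9 3 6,
        .ifThenElse (.eq 9 5) [.store 5 6 8, .store 6 6 7] [.store 5 6 7, .store 6 6 8],
        .store 7 7 5, .store 7 8 5, .store 9 7 5, .store 9 8 5, .store 10 7 5, .store 10 8 5,
        .succ 6 6]]

/-- Builds the linked lists of arcs by tail, with heads in array `7` and successors in array `8`,
and counts the out-degrees in array `9`. -/
def linkCode : List Instr :=
  [.const 6 0,
    .loop (.lt 6 2)
      [.load 7 5 6, .load 8 7 7, .store 8 6 8, .load 9 9 7, .succ 9 9, .store 9 7 9, .succ 6 6,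
        .store 7 7 6]]

/-- Scans the arcs in the list at the pointer in register `7`. A head that is not yet marked is
marked (array `10`), the arc is put into the queue (array `11`, with end in register `8`), and the
pointer in register `10` to the preceding arc is recorded (array `12`). -/
def scanCode : List Instr :=
  [.loop (.ne 7 5)
    [.pred 6 7, .load 7 8 6, .load 11 6 6, .load 12 10 11,
      .ifThenElse (.eq 12 5) [.store 10 11 13, .store 12 6 10, .store 11 8 6, .succ 8 8] []]]

/-- Breadth-first search from the vertex `l`; register `9` is the front of the queue. -/
def searchCode : List Instr :=
  [.const 8 0, .const 9 0, .const 10 0, .const 13 1, .store 10 3 13, .load 7 7 3] ++ (scanCode ++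
    [.loop (.lt 9 8)
      ([.load 6 11 9, .succ 9 9, .succ 10 6, .load 11 6 6, .load 7 7 11] ++ scanCode)])

/-- Finds in the queue an arc whose head is a vertex of `A` (a number at least `n`) of least
out-degree. Register `14` receives a pointer to it. -/
def pickCode : List Instr :=
  [.const 9 0, .const 14 0, .succ 15 2,
    .loop (.lt 9 8)
      [.load 6 11 9, .succ 9 9, .load 11 6 6,
        .ifThenElse (.le 1 11)
          [.load 12 9 11, .ifThenElse (.lt 12 15) [.succ 14 6, .copy 15 12] []] []]]

/-- Flips membership in `F` along the path traced back from the pointer in register `14`. -/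
def flipCode : List Instr :=
  [.loop (.ne 14 5)
    [.pred 6 14, .load 7 3 6, .ifThenElse (.eq 7 5) [.store 3 6 13] [.store 3 6 5],
      .load 14 12 6]]

/-- Counts the pass, and goes on to the next vertex of `B` when the need is met. -/
def advanceCode : List Instr :=
  [.succ 4 4, .load 6 0 3, .ifThenElse (.eq 4 6) [.succ 3 3, .const 4 0] []]

/-- One pass of the inner loop of the algorithm. -/
def passCode : List Instr :=
  labelCode ++ (orientCode ++ (linkCode ++ (searchCode ++ (pickCode ++ (flipCode ++ advanceCode)))))

/-- The two nested loops of the algorithm, merged into a single one. -/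
def mainCode : List Instr := [.loop (.lt 3 1) passCode]

/-! ### Specifications of the parts of a pass -/

theorem wp_label (s : Store) (t : ℕ) :
    WP labelCode s t fun t' s' => t' ≤ t + 5 * s.reg 2 + 3 ∧ Frame {6, 7, 8} {4} s s' ∧
      ∀ j < s.reg 2, ∃ i < s.reg 2, s.arr 1 i = s.arr 1 j ∧
        s'.arr 4 (s.arr 1 j) = s.reg 1 + i := by
  simp only [labelCode, wp_const, wp_copy]
  refine wp_loop (t + 2 + 5 * s.reg 2) (fun t' s' => t' + 5 * (s.reg 2 - s'.reg 6) ≤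
      t + 2 + 5 * s.reg 2 ∧ Frame {6, 7, 8} {4} s s' ∧ s'.reg 6 ≤ s.reg 2 ∧
      s'.reg 7 = s.reg 1 + s'.reg 6 ∧
      ∀ j < s'.reg 6, ∃ i < s.reg 2, s.arr 1 i = s.arr 1 j ∧
        s'.arr 4 (s.arr 1 j) = s.reg 1 + i) ?_ ?_ ?_ ?_
  · simp
    exact ((Frame.refl _ _ s).setReg (by simp) _).setReg (by simp) _
  · rintro t' s' ⟨h, -⟩; omega
  · rintro t' s' ⟨h1, h2, h3, h4, h5⟩ hc
    have e2 := h2.reg 2 (by simp)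
    have a1 := h2.arr 1 (by simp)
    simp [e2] at hc
    simp [a1, h4]
    refine ⟨by omega, ?_, by omega, by omega, ?_⟩
    · refine (((h2.setReg (by simp) _).setArr (by simp) _ _).setReg (by simp) _).setReg (by simp) _
    · intro j hj
      by_cases hjk : s.arr 1 j = s.arr 1 (s'.reg 6)
      · exact ⟨s'.reg 6, hc, hjk.symm, by rw [hjk, Function.update_self]⟩
      · rw [Function.update_of_ne hjk]
        refine h5 j ?_
        rcases hj.lt_or_eq with h | rfl
        · exact h
        · exact absurd rfl hjk
  · rintro t' s' ⟨h1, h2, h3, h4, h5⟩ hc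
    have e2 := h2.reg 2 (by simp)
    simp [e2] at hc
    exact ⟨by omega, h2, fun j hj => h5 j (by omega)⟩

theorem wp_orient (s : Store) (t : ℕ) (h5 : s.reg 5 = 0) :
    WP orientCode s t fun t' s' => t' ≤ t + 15 * s.reg 2 + 2 ∧
      Frame {6, 7, 8, 9} {5, 6, 7, 9, 10} s s' ∧
      ∀ k < s.reg 2,
        s'.arr 5 k = (if s.arr 3 k = 0 then s.arr 2 k else s.arr 4 (s.arr 1 k)) ∧
        s'.arr 6 k = (if s.arr 3 k = 0 then s.arr 4 (s.arr 1 k) else s.arr 2 k) ∧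
        ∀ v, v = s.arr 2 k ∨ v = s.arr 4 (s.arr 1 k) →
          s'.arr 7 v = 0 ∧ s'.arr 9 v = 0 ∧ s'.arr 10 v = 0 := by
  simp only [orientCode, wp_const]
  refine wp_loop (t + 1 + 15 * s.reg 2) (fun t' s' => t' + 15 * (s.reg 2 - s'.reg 6) ≤
      t + 1 + 15 * s.reg 2 ∧ Frame {6, 7, 8, 9} {5, 6, 7, 9, 10} s s' ∧ s'.reg 6 ≤ s.reg 2 ∧
      ∀ k < s'.reg 6,
        s'.arr 5 k = (if s.arr 3 k = 0 then s.arr 2 k else s.arr 4 (s.arr 1 k)) ∧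
        s'.arr 6 k = (if s.arr 3 k = 0 then s.arr 4 (s.arr 1 k) else s.arr 2 k) ∧
        ∀ v, v = s.arr 2 k ∨ v = s.arr 4 (s.arr 1 k) →
          s'.arr 7 v = 0 ∧ s'.arr 9 v = 0 ∧ s'.arr 10 v = 0) ?_ ?_ ?_ ?_
  · simp
    exact (Frame.refl _ _ s).setReg (by simp) _
  · rintro t' s' ⟨h, -⟩; omega
  · rintro t' s' ⟨h1, h2, h3, h4⟩ hc
    have e2 := h2.reg 2 (by simp)
    have e5 := h2.reg 5 (by simp)
    have a1 := h2.arr 1 (by simp)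
    have a2 := h2.arr 2 (by simp)
    have a3 := h2.arr 3 (by simp)
    have a4 := h2.arr 4 (by simp)
    simp [e2] at hc
    -- Resetting the cells of the two ends of the current edge keeps earlier cells equal to `0`.
    have key : ∀ v k, k ≤ s'.reg 6 → (v = s.arr 2 k ∨ v = s.arr 4 (s.arr 1 k)) →
        ∀ f : ℕ → ℕ, (k < s'.reg 6 → f v = 0) →
        Function.update (Function.update f (s.arr 4 (s.arr 1 (s'.reg 6))) 0)
          (s.arr 2 (s'.reg 6)) 0 v = 0 := by
      intro v k hk hv f hf
      rw [Function.update_apply, Function.update_apply]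
      split_ifs with hv1 hv2
      · rfl
      · rfl
      · refine hf ?_
        rcases hk.lt_or_eq with h | rfl
        · exact h
        · rcases hv with hv | hv <;> contradiction
    simp [a1, a2, a3, a4, e5, h5, -forall_eq_or_imp]
    split_ifs with hF
    all_goals
      refine ⟨by omega, ?_, by omega, ?_⟩
      · repeat first
          | exact h2
          | refine Frame.setReg ?_ (by simp) _
          | refine Frame.setArr ?_ (by simp) _ _
      · intro k hk
        refine ⟨?_, ?_, fun v hv => ⟨key v k hk hv _ fun h => ((h4 k h).2.2 v hv).1,
          key v k hk hv _ fun h => ((h4 k h).2.2 v hv).2.1,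
          key v k hk hv _ fun h => ((h4 k h).2.2 v hv).2.2⟩⟩
        all_goals
          rcases hk.lt_or_eq with h | rfl
          · rw [Function.update_of_ne h.ne]
            first | exact (h4 k h).1 | exact (h4 k h).2.1
          · simp [hF]
  · rintro t' s' ⟨h1, h2, h3, h4⟩ hc
    have e2 := h2.reg 2 (by simp)
    simp [e2] at hc
    exact ⟨by omega, h2, fun k hk => h4 k (by omega)⟩

theorem wp_link (s : Store) (t : ℕ) :
    WP linkCode s t fun t' s' => t' ≤ t + 9 * s.reg 2 + 2 ∧
      Frame {6, 7, 8, 9} {7, 8, 9} s s' ∧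
      ∀ v, s.arr 7 v = 0 → s.arr 9 v = 0 →
        LinkedList (s'.arr 8) (s'.arr 7 v) (outList (s.arr 5) (s.reg 2) v) ∧
        s'.arr 9 v = (outList (s.arr 5) (s.reg 2) v).length := by
  simp only [linkCode, wp_const]
  refine wp_loop (t + 1 + 9 * s.reg 2) (fun t' s' => t' + 9 * (s.reg 2 - s'.reg 6) ≤
      t + 1 + 9 * s.reg 2 ∧ Frame {6, 7, 8, 9} {7, 8, 9} s s' ∧ s'.reg 6 ≤ s.reg 2 ∧
      ∀ v, s.arr 7 v = 0 → s.arr 9 v = 0 →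
        LinkedList (s'.arr 8) (s'.arr 7 v) (outList (s.arr 5) (s'.reg 6) v) ∧
        s'.arr 9 v = (outList (s.arr 5) (s'.reg 6) v).length) ?_ ?_ ?_ ?_
  · simp [outList]
    refine ⟨(Frame.refl _ _ s).setReg (by simp) _, fun v hv hv' => ⟨?_, hv'⟩⟩
    rw [hv]; exact .nil
  · rintro t' s' ⟨h, -⟩; omega
  · rintro t' s' ⟨h1, h2, h3, h4⟩ hc
    have e2 := h2.reg 2 (by simp)
    have a5 := h2.arr 5 (by simp)
    simp [e2] at hc
    simp [a5]
    refine ⟨by omega, ?_, by omega, ?_⟩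
    · repeat first
        | exact h2
        | refine Frame.setReg ?_ (by simp) _
        | refine Frame.setArr ?_ (by simp) _ _
    · intro v hv hv'
      obtain ⟨h5, h6⟩ := h4 v hv hv'
      have hcong : ∀ x ∈ outList (s.arr 5) (s'.reg 6) v,
          Function.update (s'.arr 8) (s'.reg 6) (s'.arr 7 (s.arr 5 (s'.reg 6))) x =
            s'.arr 8 x := fun x hx => Function.update_of_ne (mem_outList.1 hx).1.ne _ _
      rw [outList]
      split_ifs with htl
      · rw [← htl] at h5 h6 hcong ⊢
        rw [Function.update_self, Function.update_self]
        refine ⟨.cons ?_, by simp [h6]⟩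
        rw [Function.update_self]
        exact h5.congr hcong
      · rw [Function.update_of_ne (Ne.symm htl), Function.update_of_ne (Ne.symm htl)]
        exact ⟨h5.congr hcong, h6⟩
  · rintro t' s' ⟨h1, h2, h3, h4⟩ hc
    have e2 := h2.reg 2 (by simp)
    simp [e2] at hc
    have e6 : s'.reg 6 = s.reg 2 := by omega
    rw [e6] at h4
    exact ⟨by omega, h2, h4⟩

theorem wp_scan (s : Store) (t : ℕ) {m src v : ℕ} {R L : List ℕ} (h5 : s.reg 5 = 0)
    (h13 : s.reg 13 = 1)
    (hS : SearchState m (s.arr 5) (s.arr 6) src (s.arr 10) (s.arr 11) (s.arr 12) (s.reg 8))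
    (hR : LinkedList (s.arr 8) (s.reg 7) R) (hRv : ∀ x ∈ R, x < m ∧ s.arr 5 x = v)
    (hL : LinkedList (s.arr 12) (s.reg 10) L) (hp : ArcPath m (s.arr 5) (s.arr 6) src L v)
    (hLq : ∀ x ∈ L, ∃ i < s.reg 8, s.arr 6 (s.arr 11 i) = s.arr 6 x) :
    WP scanCode s t fun t' s' => t' ≤ t + 10 * R.length + 1 ∧
      Frame {6, 7, 8, 11, 12} {10, 11, 12} s s' ∧
      SearchState m (s.arr 5) (s.arr 6) src (s'.arr 10) (s'.arr 11) (s'.arr 12) (s'.reg 8) ∧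
      s.reg 8 ≤ s'.reg 8 ∧ (∀ j < s.reg 8, s'.arr 11 j = s.arr 11 j) ∧
      ∀ x ∈ R, s'.arr 10 (s.arr 6 x) ≠ 0 := by
  refine wp_loop (t + 10 * R.length) (fun t' s' => ∃ R', LinkedList (s.arr 8) (s'.reg 7) R' ∧
      (∀ x ∈ R', x ∈ R) ∧ (∀ x ∈ R, x ∈ R' ∨ s'.arr 10 (s.arr 6 x) ≠ 0) ∧
      t' + 10 * R'.length ≤ t + 10 * R.length ∧
      Frame {6, 7, 8, 11, 12} {10, 11, 12} s s' ∧
      SearchState m (s.arr 5) (s.arr 6) src (s'.arr 10) (s'.arr 11) (s'.arr 12) (s'.reg 8) ∧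
      s.reg 8 ≤ s'.reg 8 ∧ (∀ j < s.reg 8, s'.arr 11 j = s.arr 11 j) ∧
      LinkedList (s'.arr 12) (s.reg 10) L) ?_ ?_ ?_ ?_
  · exact ⟨R, hR, fun _ => id, fun _ => Or.inl, le_rfl, Frame.refl _ _ s, hS, le_rfl,
      fun _ _ => rfl, hL⟩
  · rintro t' s' ⟨R', -, -, -, h, -⟩; omega
  · rintro t' s' ⟨R', i1, i2, i3, i4, hfr, i6, i7, i8, i9⟩ hc
    have e5 := hfr.reg 5 (by simp)
    have e10 := hfr.reg 10 (by simp)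
    have e13 := hfr.reg 13 (by simp)
    have a5 := hfr.arr 5 (by simp)
    have a6 := hfr.arr 6 (by simp)
    have a8 := hfr.arr 8 (by simp)
    simp [e5, h5] at hc
    obtain ⟨k, hk⟩ := Nat.exists_eq_succ_of_ne_zero hc
    rw [Nat.succ_eq_add_one] at hk
    rw [hk] at i1
    obtain ⟨R'', rfl, i1'⟩ := i1.of_succ
    have hkR := hRv k (i2 k (by simp))
    have hLq' : ∀ x ∈ L, ∃ i < s'.reg 8, s.arr 6 (s'.arr 11 i) = s.arr 6 x := by
      intro x hx
      obtain ⟨i, hi, hix⟩ := hLq x hx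
      exact ⟨i, by omega, by rwa [i8 i hi]⟩
    rw [List.length_cons] at i4
    simp [hk, a6, a8, e5, h5, e10, e13, h13]
    split_ifs with hvis
    · refine ⟨R'', i1', fun x hx => i2 x (by simp [hx]), ?_, by omega, ?_, ?_, by omega, ?_, ?_⟩
      · intro x hx
        rw [Function.update_apply]
        split_ifs with hxk
        · exact Or.inr (by simp)
        · rcases i3 x hx with h | h
          · rw [List.mem_cons] at h
            rcases h with rfl | h
            · exact absurd rfl hxk
            · exact Or.inl h
          · exact Or.inr h
      · repeat first
          | exact hfr
          | refine Frame.setReg ?_ (by simp) _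
          | refine Frame.setArr ?_ (by simp) _ _
      · exact i6.visit hkR.1 hvis i9 (hkR.2 ▸ hp) hLq'
      · intro j hj
        rw [Function.update_of_ne (by omega), i8 j hj]
      · exact i6.linkedList_update hkR.1 hvis i9 hLq'
    · refine ⟨R'', i1', fun x hx => i2 x (by simp [hx]), ?_, by omega, ?_, i6, by omega, i8, i9⟩
      · intro x hx
        rcases i3 x hx with h | h
        · rw [List.mem_cons] at h
          rcases h with rfl | h
          · exact Or.inr hvis
          · exact Or.inl h
        · exact Or.inr h
      · repeat first
          | exact hfr
          | refine Frame.setReg ?_ (by simp) _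
  · rintro t' s' ⟨R', i1, i2, i3, i4, hfr, i6, i7, i8, i9⟩ hc
    have e5 := hfr.reg 5 (by simp)
    simp [e5, h5] at hc
    rw [hc] at i1
    obtain rfl := i1.of_zero
    exact ⟨by simpa using i4, hfr, i6, i7, i8, fun x hx => (i3 x hx).resolve_left (by simp)⟩

/-- The arcs whose tail is neither `src` nor among the first `h` vertices of the queue, that is, the
arcs whose lists have not been scanned. -/
def pendingArcs (m : ℕ) (tl hd : ℕ → ℕ) (src : ℕ) (que : ℕ → ℕ) (h : ℕ) : Finset ℕ :=
  {k ∈ range m | tl k ≠ src ∧ ∀ j < h, hd (que j) ≠ tl k}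

theorem card_pendingArcs_zero (m : ℕ) (tl hd : ℕ → ℕ) (src : ℕ) (que : ℕ → ℕ) :
    #(pendingArcs m tl hd src que 0) + (outList tl m src).length ≤ m := by
  rw [length_outList, pendingArcs, ← card_union_of_disjoint, ← filter_or]
  · exact (card_filter_le _ _).trans (card_range m).le
  · rw [disjoint_filter]
    rintro x - h h'
    exact h.1 h'

theorem card_pendingArcs_succ (m : ℕ) (tl hd : ℕ → ℕ) (src : ℕ) {que que' : ℕ → ℕ} {h : ℕ}
    (hq : ∀ j ≤ h, que' j = que j) (hsrc : hd (que h) ≠ src)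
    (hne : ∀ j < h, hd (que j) ≠ hd (que h)) :
    #(pendingArcs m tl hd src que' (h + 1)) + (outList tl m (hd (que h))).length ≤
      #(pendingArcs m tl hd src que h) := by
  rw [length_outList, pendingArcs, pendingArcs, ← card_union_of_disjoint, ← filter_or]
  · refine card_le_card (monotone_filter_right _ ?_)
    rintro x - h'
    rcases h' with h' | h'
    · exact ⟨h'.1, fun j hj => hq j hj.le ▸ h'.2 j (by omega)⟩
    · rw [h']
      exact ⟨hsrc, hne⟩
  · rw [disjoint_filter]
    rintro x - h' h''
    exact h'.2 h (by omega) (by rw [hq h le_rfl, h''])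

/-- The search takes linear time, and afterwards the marked vertices are closed under arcs. -/
theorem wp_search (s : Store) (t : ℕ) (h5 : s.reg 5 = 0)
    (hfirst : ∀ v, (v = s.reg 3 ∨ ∃ k < s.reg 2, s.arr 6 k = v) →
      LinkedList (s.arr 8) (s.arr 7 v) (outList (s.arr 5) (s.reg 2) v))
    (hvis : ∀ k < s.reg 2, s.arr 10 (s.arr 6 k) = 0) :
    WP searchCode s t fun t' s' => t' ≤ t + 17 * s.reg 2 + 8 ∧
      Frame {6, 7, 8, 9, 10, 11, 12, 13} {10, 11, 12} s s' ∧ s'.reg 13 = 1 ∧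
      SearchState (s.reg 2) (s.arr 5) (s.arr 6) (s.reg 3) (s'.arr 10) (s'.arr 11) (s'.arr 12)
        (s'.reg 8) ∧
      ∀ k < s.reg 2, (s.arr 5 k = s.reg 3 ∨ ∃ j < s'.reg 8, s.arr 6 (s'.arr 11 j) = s.arr 5 k) →
        s'.arr 10 (s.arr 6 k) ≠ 0 := by
  refine WP.append ?_
  simp
  refine WP.append ?_
  have hS : SearchState (s.reg 2) (s.arr 5) (s.arr 6) (s.reg 3)
      (Function.update (s.arr 10) (s.reg 3) 1) (s.arr 11) (s.arr 12) 0 := by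
    refine ⟨fun k hk => ?_, by simp, by simp, by simp⟩
    rw [Function.update_apply]
    split_ifs with h <;> simp [h, hvis k hk]
  refine (wp_scan (m := s.reg 2) (src := s.reg 3) (v := s.reg 3) (L := [])
    (R := outList (s.arr 5) (s.reg 2) (s.reg 3)) _ _ ?_ ?_ ?_ ?_ ?_
    ?_ ?_ ?_).mono ?_
  · simpa using h5
  · simp
  · simpa using hS
  · simpa using hfirst _ (Or.inl rfl)
  · intro x hx
    simpa [mem_outList] using hx
  · simpa using LinkedList.nil
  · simpa using ArcPath.nil
  · simp
  rintro t₁ s₁ ⟨ht₁, hfr₁, hS₁, -, -, hvis₁⟩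
  simp at ht₁ hS₁ hvis₁
  have hfr : Frame {6, 7, 8, 9, 10, 11, 12, 13} {10, 11, 12} s s₁ := by
    refine Frame.trans ?_ hfr₁ (by decide) (by decide)
    repeat first
      | exact Frame.refl _ _ _
      | refine Frame.setReg ?_ (by simp) _
      | refine Frame.setArr ?_ (by simp) _ _
  have e9₁ : s₁.reg 9 = 0 := by simpa using hfr₁.reg 9 (by simp)
  have e13₁ : s₁.reg 13 = 1 := by simpa using hfr₁.reg 13 (by simp)
  -- Time is paid for by the arcs still to be scanned and the vertices still to be dequeued.
  refine wp_loop (t + 7 + 17 * s.reg 2) (fun t' s' =>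
      t' + 10 * #(pendingArcs (s.reg 2) (s.arr 5) (s.arr 6) (s.reg 3) (s'.arr 11) (s'.reg 9)) +
        7 * (s.reg 2 - s'.reg 9) ≤ t + 7 + 17 * s.reg 2 ∧
      Frame {6, 7, 8, 9, 10, 11, 12, 13} {10, 11, 12} s s' ∧ s'.reg 13 = 1 ∧
      s'.reg 9 ≤ s'.reg 8 ∧
      SearchState (s.reg 2) (s.arr 5) (s.arr 6) (s.reg 3) (s'.arr 10) (s'.arr 11) (s'.arr 12)
        (s'.reg 8) ∧
      ∀ k < s.reg 2, (s.arr 5 k = s.reg 3 ∨ ∃ j < s'.reg 9, s.arr 6 (s'.arr 11 j) = s.arr 5 k) →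
        s'.arr 10 (s.arr 6 k) ≠ 0) ?_ ?_ ?_ ?_
  · refine ⟨?_, hfr, e13₁, by omega, hS₁, ?_⟩
    · have := card_pendingArcs_zero (s.reg 2) (s.arr 5) (s.arr 6) (s.reg 3) (s₁.arr 11)
      rw [e9₁]
      omega
    · intro k hk h
      rw [e9₁] at h
      refine hvis₁ k (mem_outList.2 ⟨hk, h.resolve_right (by simp)⟩)
  · rintro t' s' ⟨h, -⟩; omega
  · rintro t' s' ⟨i1, hfr, e13, i4, i5, i6⟩ hc
    have e5 := hfr.reg 5 (by simp)
    have a5 := hfr.arr 5 (by simp)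
    have a6 := hfr.arr 6 (by simp)
    have a7 := hfr.arr 7 (by simp)
    have a8 := hfr.arr 8 (by simp)
    simp at hc
    have hle := i5.le
    obtain ⟨L, hL1, hL2, hL3⟩ := i5.path _ hc
    have hlt := i5.que_lt _ hc
    simp [a6, a7]
    refine (wp_scan (m := s.reg 2) (src := s.reg 3) (v := s.arr 6 (s'.arr 11 (s'.reg 9)))
      (L := L) (R := outList (s.arr 5) (s.reg 2) (s.arr 6 (s'.arr 11 (s'.reg 9)))) _ _
      ?_ ?_ ?_ ?_ ?_ ?_ ?_ ?_).mono ?_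
    · simpa using e5.trans h5
    · simpa using e13
    · simpa [a5, a6] using i5
    · simpa [a8] using hfirst _ (Or.inr ⟨_, hlt, rfl⟩)
    · intro x hx
      simpa [mem_outList, a5] using hx
    · simpa using hL1
    · simpa [a5, a6] using hL2
    · simpa [a6] using hL3
    rintro t₂ s₂ ⟨ht₂, hfr₂, hS₂, hq₂, hque₂, hvis₂⟩
    simp [a5, a6] at ht₂ hS₂ hq₂ hque₂ hvis₂
    have e9₂ : s₂.reg 9 = s'.reg 9 + 1 := by simpa using hfr₂.reg 9 (by simp)
    have e13₂ : s₂.reg 13 = 1 := by simpa [e13] using hfr₂.reg 13 (by simp)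
    have hsrc : s.arr 6 (s'.arr 11 (s'.reg 9)) ≠ s.reg 3 := by
      cases hL1 with
      | cons => cases hL2 with
        | cons _ _ h _ => exact h
    have hcard := card_pendingArcs_succ (s.reg 2) (s.arr 5) (s.arr 6) (s.reg 3)
      (que := s'.arr 11) (que' := s₂.arr 11) (h := s'.reg 9) (fun j hj => hque₂ j (by omega))
      hsrc (fun j hj => i5.que_ne _ _ hj hc)
    refine ⟨?_, ?_, e13₂, by omega, hS₂, ?_⟩
    · rw [e9₂]; omega
    · refine Frame.trans ?_ hfr₂ (by decide) (by decide)
      repeat first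
        | exact hfr
        | refine Frame.setReg ?_ (by simp) _
    · intro k hk h
      rw [e9₂] at h
      by_cases hkv : s.arr 5 k = s.arr 6 (s'.arr 11 (s'.reg 9))
      · exact hvis₂ k (mem_outList.2 ⟨hk, hkv⟩)
      · refine (hS₂.vis_iff k hk).2 ?_
        have h' : s'.arr 10 (s.arr 6 k) ≠ 0 := by
          refine i6 k hk (h.imp_right ?_)
          rintro ⟨j, hj, hjk⟩
          rw [hque₂ j (by omega)] at hjk
          refine ⟨j, (Nat.lt_succ_iff_lt_or_eq.1 hj).resolve_right ?_, hjk⟩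
          rintro rfl
          exact hkv hjk.symm
        refine ((i5.vis_iff k hk).1 h').imp_right ?_
        rintro ⟨j, hj, hjk⟩
        exact ⟨j, by omega, by rwa [hque₂ j hj]⟩
  · rintro t' s' ⟨i1, hfr, e13, i4, i5, i6⟩ hc
    simp at hc
    obtain e9 : s'.reg 9 = s'.reg 8 := by omega
    rw [e9] at i6
    exact ⟨by omega, hfr, e13, i5, i6⟩

/-- The bound on the out-degrees makes `m + 1` a valid initial value for the minimum. -/
theorem wp_pick (s : Store) (t : ℕ)
    (hdeg : ∀ j < s.reg 8, s.arr 9 (s.arr 6 (s.arr 11 j)) ≤ s.reg 2)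
    (hex : ∃ j < s.reg 8, s.reg 1 ≤ s.arr 6 (s.arr 11 j)) :
    WP pickCode s t fun t' s' => t' ≤ t + 9 * s.reg 8 + 4 ∧
      Frame {6, 9, 11, 12, 14, 15} ∅ s s' ∧
      ∃ i < s.reg 8, s'.reg 14 = s.arr 11 i + 1 ∧ s.reg 1 ≤ s.arr 6 (s.arr 11 i) ∧
        ∀ j < s.reg 8, s.reg 1 ≤ s.arr 6 (s.arr 11 j) →
          s.arr 9 (s.arr 6 (s.arr 11 i)) ≤ s.arr 9 (s.arr 6 (s.arr 11 j)) := by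
  simp only [pickCode, wp_const, wp_succ]
  refine wp_loop (t + 3 + 9 * s.reg 8) (fun t' s' => t' + 9 * (s.reg 8 - s'.reg 9) ≤
      t + 3 + 9 * s.reg 8 ∧ Frame {6, 9, 11, 12, 14, 15} ∅ s s' ∧ s'.reg 9 ≤ s.reg 8 ∧
      (∀ j < s'.reg 9, s.reg 1 ≤ s.arr 6 (s.arr 11 j) →
        s'.reg 15 ≤ s.arr 9 (s.arr 6 (s.arr 11 j))) ∧
      (s'.reg 15 = s.reg 2 + 1 ∨
        ∃ i < s'.reg 9, s'.reg 14 = s.arr 11 i + 1 ∧ s.reg 1 ≤ s.arr 6 (s.arr 11 i) ∧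
          s'.reg 15 = s.arr 9 (s.arr 6 (s.arr 11 i)))) ?_ ?_ ?_ ?_
  · simp
    repeat first
      | exact Frame.refl _ _ _
      | refine Frame.setReg ?_ (by simp) _
  · rintro t' s' ⟨h, -⟩; omega
  · rintro t' s' ⟨i1, hfr, i3, i4, i5⟩ hc
    have e1 := hfr.reg 1 (by simp)
    have e8 := hfr.reg 8 (by simp)
    have a6 := hfr.arr 6 (by simp)
    have a9 := hfr.arr 9 (by simp)
    have a11 := hfr.arr 11 (by simp)
    simp [e8] at hc
    simp [e1, a6, a9, a11]
    split_ifs with hn hd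
    all_goals
      refine ⟨by omega, ?_, by omega, ?_, ?_⟩
      · repeat first
          | exact hfr
          | refine Frame.setReg ?_ (by simp) _
    · intro j hj hj'
      rcases hj.lt_or_eq with h | rfl
      · exact hd.le.trans (i4 j h hj')
      · exact le_rfl
    · exact Or.inr ⟨s'.reg 9, le_rfl, rfl, hn, rfl⟩
    · intro j hj hj'
      rcases hj.lt_or_eq with h | rfl
      · exact i4 j h hj'
      · omega
    · exact i5.imp_right fun ⟨i, hi, h⟩ => ⟨i, hi.le, h⟩
    · intro j hj hj'
      rcases hj.lt_or_eq with h | rfl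
      · exact i4 j h hj'
      · contradiction
    · exact i5.imp_right fun ⟨i, hi, h⟩ => ⟨i, hi.le, h⟩
  · rintro t' s' ⟨i1, hfr, i3, i4, i5⟩ hc
    have e8 := hfr.reg 8 (by simp)
    simp [e8] at hc
    have e9 : s'.reg 9 = s.reg 8 := by omega
    rw [e9] at i4 i5
    refine ⟨by omega, hfr, ?_⟩
    rcases i5 with h | ⟨i, hi, h1, h2, h3⟩
    · obtain ⟨j, hj, hj'⟩ := hex
      have := i4 j hj hj'
      have := hdeg j hj
      omega
    · exact ⟨i, hi, h1, h2, fun j hj hj' => h3 ▸ i4 j hj hj'⟩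

theorem wp_flip (s : Store) (t : ℕ) (h5 : s.reg 5 = 0) (h13 : s.reg 13 = 1) {L : List ℕ}
    (hL : LinkedList (s.arr 12) (s.reg 14) L) (hnd : L.Nodup) :
    WP flipCode s t fun t' s' => t' ≤ t + 6 * L.length + 1 ∧
      Frame {6, 7, 14} {3} s s' ∧
      ∀ k, s'.arr 3 k = if k ∈ L then (if s.arr 3 k = 0 then 1 else 0) else s.arr 3 k := by
  refine wp_loop (t + 6 * L.length) (fun t' s' => ∃ L₁ L₂, L = L₁ ++ L₂ ∧
      LinkedList (s.arr 12) (s'.reg 14) L₂ ∧ t' + 6 * L₂.length ≤ t + 6 * L.length ∧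
      Frame {6, 7, 14} {3} s s' ∧
      ∀ k, s'.arr 3 k = if k ∈ L₁ then (if s.arr 3 k = 0 then 1 else 0) else s.arr 3 k)
    ?_ ?_ ?_ ?_
  · exact ⟨[], L, rfl, hL, le_rfl, Frame.refl _ _ s, by simp⟩
  · rintro t' s' ⟨L₁, L₂, -, -, h, -⟩; omega
  · rintro t' s' ⟨L₁, L₂, rfl, i2, i3, hfr, i5⟩ hc
    have e5 := hfr.reg 5 (by simp)
    have e13 := hfr.reg 13 (by simp)
    have a12 := hfr.arr 12 (by simp)
    simp [e5, h5] at hc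
    obtain ⟨k, hk⟩ := Nat.exists_eq_succ_of_ne_zero hc
    rw [Nat.succ_eq_add_one] at hk
    rw [hk] at i2
    obtain ⟨L₃, rfl, i2'⟩ := i2.of_succ
    have hkL : k ∉ L₁ := fun h => (List.nodup_append.1 hnd).2.2 k h k (by simp) rfl
    have hk3 : s'.arr 3 k = s.arr 3 k := by rw [i5, if_neg hkL]
    simp only [List.length_append, List.length_cons] at i3
    simp [hk, e5, h5, e13, h13, a12, hk3]
    split_ifs with hF
    all_goals
      refine ⟨L₁ ++ [k], L₃, by simp, i2', by omega, ?_, ?_⟩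
      · repeat first
          | exact hfr
          | refine Frame.setReg ?_ (by simp) _
          | refine Frame.setArr ?_ (by simp) _ _
      · intro x
        simp only [Function.update_apply, i5, List.mem_append, List.mem_singleton]
        by_cases hx : x = k
        · simp [hx, hF]
        · simp [hx]
  · rintro t' s' ⟨L₁, L₂, rfl, i2, i3, hfr, i5⟩ hc
    have e5 := hfr.reg 5 (by simp)
    simp [e5, h5] at hc
    rw [hc] at i2
    obtain rfl := i2.of_zero
    simp only [List.append_nil] at i3 ⊢
    exact ⟨by simpa using i3, hfr, i5⟩

theorem wp_advance (s : Store) (t : ℕ) :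
    WP advanceCode s t fun t' s' => t' ≤ t + 5 ∧ Frame {3, 4, 6} ∅ s s' ∧
      if s.reg 4 + 1 = s.arr 0 (s.reg 3) then s'.reg 3 = s.reg 3 + 1 ∧ s'.reg 4 = 0
      else s'.reg 3 = s.reg 3 ∧ s'.reg 4 = s.reg 4 + 1 := by
  simp [advanceCode]
  split_ifs with h
  all_goals
    refine ⟨?_, h⟩
    repeat first
      | exact Frame.refl _ _ _
      | refine Frame.setReg ?_ (by simp) _

/-! ### The digraph of the program and alternating walks -/

section Encoding

variable {p n m : ℕ} {G : SimpleGraph (Fin p ⊕ Fin n)}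

/-- The edge with index `k`. -/
def edgeOf (e : Fin m ≃ EdgePair G) (k : Fin m) : Sym2 (Fin p ⊕ Fin n) :=
  s(Sum.inl (e k).1.1, Sum.inr (e k).1.2)

theorem edgeOf_mem (e : Fin m ≃ EdgePair G) (k : Fin m) : edgeOf e k ∈ G.edgeSet := (e k).2

theorem edgeOf_injective (e : Fin m ≃ EdgePair G) : Function.Injective (edgeOf e) := by
  intro k k' h
  simp only [edgeOf, Sym2.eq_iff, Sum.inl.injEq, Sum.inr.injEq, reduceCtorEq, and_self,
    or_false] at h
  exact e.injective (Subtype.ext (Prod.ext h.1 h.2))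

theorem exists_edgeOf_eq (e : Fin m ≃ EdgePair G) {a : Fin p} {y : Fin n}
    (h : G.Adj (Sum.inl a) (Sum.inr y)) : ∃ k, (e k).1.1 = a ∧ (e k).1.2 = y :=
  ⟨e.symm ⟨(a, y), h⟩, by simp, by simp⟩

theorem ncard_edgeSet (hG : G ≤ completeBipartiteGraph (Fin p) (Fin n))
    (e : Fin m ≃ EdgePair G) : G.edgeSet.ncard = m := by
  have h : G.edgeSet = Set.range (edgeOf e) := by
    ext x
    constructor
    · induction x with
      | _ u v =>
        intro h
        rcases adj_cases hG h with ⟨a, y, rfl, rfl⟩ | ⟨a, y, rfl, rfl⟩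
        · obtain ⟨k, rfl, rfl⟩ := exists_edgeOf_eq e h
          exact ⟨k, rfl⟩
        · obtain ⟨k, rfl, rfl⟩ := exists_edgeOf_eq e h.symm
          exact ⟨k, Sym2.eq_swap⟩
    · rintro ⟨k, rfl⟩
      exact edgeOf_mem e k
  rw [h, ← Set.image_univ, Set.ncard_image_of_injective _ (edgeOf_injective e), Set.ncard_univ,
    Nat.card_eq_fintype_card, Fintype.card_fin]

/-- The arrays `tl` and `hd` list the tails and heads of the arcs of `F`, with vertices numbered by
`num`. Isolated vertices of `A` may have arbitrary numbers. -/
structure Encodes (e : Fin m ≃ EdgePair G) (F : Finset (Sym2 (Fin p ⊕ Fin n)))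
    (num : Fin p ⊕ Fin n → ℕ) (tl hd : ℕ → ℕ) : Prop where
  arc : ∀ k : Fin m,
    (edgeOf e k ∈ F ∧ tl k = num (Sum.inl (e k).1.1) ∧ hd k = num (Sum.inr (e k).1.2)) ∨
    (edgeOf e k ∉ F ∧ tl k = num (Sum.inr (e k).1.2) ∧ hd k = num (Sum.inl (e k).1.1))
  num_inr : ∀ y, num (Sum.inr y) = y
  le_num_inl : ∀ k, n ≤ num (Sum.inl (e k).1.1)
  inj : ∀ k k', num (Sum.inl (e k).1.1) = num (Sum.inl (e k').1.1) → (e k).1.1 = (e k').1.1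

variable {e : Fin m ≃ EdgePair G} {F : Finset (Sym2 (Fin p ⊕ Fin n))}
  {num : Fin p ⊕ Fin n → ℕ} {tl hd : ℕ → ℕ}

theorem Encodes.le_num (h : Encodes e F num tl hd)
    (hG : G ≤ completeBipartiteGraph (Fin p) (Fin n)) {a : Fin p} {v : Fin p ⊕ Fin n}
    (ha : G.Adj (Sum.inl a) v) : n ≤ num (Sum.inl a) := by
  rcases adj_cases hG ha with ⟨a', y, h1, rfl⟩ | ⟨a', y, h1, -⟩
  · obtain ⟨k, rfl, -⟩ := exists_edgeOf_eq e ha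
    exact h.le_num_inl k
  · cases h1

theorem Encodes.num_inj (h : Encodes e F num tl hd)
    (hG : G ≤ completeBipartiteGraph (Fin p) (Fin n)) {u u' v v' : Fin p ⊕ Fin n}
    (hu : G.Adj u v) (hu' : G.Adj u' v') (hnum : num u = num u') : u = u' := by
  rcases u with a | y <;> rcases u' with a' | y'
  · rcases adj_cases hG hu with ⟨_, y, h1, rfl⟩ | ⟨_, _, h1, -⟩
    · rcases adj_cases hG hu' with ⟨_, y', h2, rfl⟩ | ⟨_, _, h2, -⟩
      · obtain ⟨k, rfl, -⟩ := exists_edgeOf_eq e hu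
        obtain ⟨k', rfl, -⟩ := exists_edgeOf_eq e hu'
        rw [h.inj k k' hnum]
      · cases h2
    · cases h1
  · have := h.le_num hG hu
    have := h.num_inr y'
    omega
  · have := h.le_num hG hu'
    have := h.num_inr y
    omega
  · rw [h.num_inr, h.num_inr] at hnum
    rw [Fin.ext hnum]

theorem Encodes.exists_index (h : Encodes e F num tl hd)
    (hG : G ≤ completeBipartiteGraph (Fin p) (Fin n)) {u v : Fin p ⊕ Fin n}
    (huv : G.Adj u v) (harc : Arc F u v) : ∃ k < m, tl k = num u ∧ hd k = num v := by
  rcases adj_cases hG huv with ⟨a, y, rfl, rfl⟩ | ⟨a, y, rfl, rfl⟩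
  · obtain ⟨k, rfl, rfl⟩ := exists_edgeOf_eq e huv
    refine ⟨k, k.2, ?_⟩
    rcases h.arc k with h' | h'
    · exact h'.2
    · exact absurd harc h'.1
  · obtain ⟨k, rfl, rfl⟩ := exists_edgeOf_eq e huv.symm
    refine ⟨k, k.2, ?_⟩
    rcases h.arc k with h' | h'
    · exact absurd (Sym2.eq_swap (a := Sum.inl (e k).1.1) ▸ h'.1) harc
    · exact h'.2

theorem Encodes.exists_arc (h : Encodes e F num tl hd) (k : Fin m) :
    ∃ u v, G.Adj u v ∧ Arc F u v ∧ tl k = num u ∧ hd k = num v ∧ s(u, v) = edgeOf e k := by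
  rcases h.arc k with h' | h'
  · exact ⟨_, _, (e k).2, h'.1, h'.2.1, h'.2.2, rfl⟩
  · refine ⟨_, _, (e k).2.symm, ?_, h'.2.1, h'.2.2, Sym2.eq_swap⟩
    have := h'.1
    rwa [edgeOf, Sym2.eq_swap] at this

/-- A path in the arrays comes from a directed path in the graph, with the same edges. -/
theorem Encodes.exists_walk (h : Encodes e F num tl hd)
    (hG : G ≤ completeBipartiteGraph (Fin p) (Fin n)) {u w : Fin p ⊕ Fin n} (hw : G.Adj u w)
    {L : List ℕ} {x : ℕ} (hL : ArcPath m tl hd (num u) L x) :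
    ∃ (v : Fin p ⊕ Fin n) (P : G.Walk u v), num v = x ∧ P.IsPath ∧ Directed F P ∧
      (∃ z, G.Adj v z) ∧ (∀ k : Fin m, edgeOf e k ∈ P.edges ↔ (k : ℕ) ∈ L) ∧
      ∀ z ∈ P.support, z = u ∨ ∃ k ∈ L, hd k = num z := by
  induction hL with
  | nil => exact ⟨u, .nil, rfl, by simp, by simp, ⟨w, hw⟩, by simp, by simp⟩
  | @cons k L _ hk hsrc hne ih =>
    obtain ⟨v, P, hv, hP, hd, ⟨z, hz⟩, hPL, hsup⟩ := ih
    obtain ⟨v', x, hadj, harc, htl, hhd, hedge⟩ := h.exists_arc ⟨k, hk⟩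
    simp only at htl hhd
    obtain rfl := h.num_inj hG hz hadj (hv.trans htl)
    refine ⟨x, P.concat hadj, hhd.symm, ?_, hd.concat hadj harc, ⟨v, hadj.symm⟩, ?_, ?_⟩
    · refine hP.concat (fun hx => ?_) hadj
      rcases hsup x hx with rfl | ⟨j, hj, hjx⟩
      · exact hsrc hhd
      · exact hne j hj (hjx.trans hhd.symm)
    · intro j
      rw [SimpleGraph.Walk.edges_concat, List.concat_eq_append, List.mem_append, hPL,
        List.mem_singleton, hedge, (edgeOf_injective e).eq_iff, List.mem_cons, Fin.ext_iff]
      exact or_comm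
    · intro j hj
      rw [SimpleGraph.Walk.support_concat, List.mem_append, List.mem_singleton] at hj
      rcases hj with hj | rfl
      · exact (hsup j hj).imp_right fun ⟨i, hi, h⟩ => ⟨i, by simp [hi], h⟩
      · exact Or.inr ⟨k, by simp, hhd⟩

theorem Encodes.fdeg_eq (h : Encodes e F num tl hd)
    (hG : G ≤ completeBipartiteGraph (Fin p) (Fin n))
    (hF : (F : Set (Sym2 (Fin p ⊕ Fin n))) ⊆ G.edgeSet) {a : Fin p} {v : Fin p ⊕ Fin n}
    (ha : G.Adj (Sum.inl a) v) :
    fdeg F (Sum.inl a) = (outList tl m (num (Sum.inl a))).length := by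
  rw [length_outList, fdeg]
  symm
  have key : ∀ k (hk : k < m), tl k = num (Sum.inl a) ↔
      edgeOf e ⟨k, hk⟩ ∈ F ∧ (e ⟨k, hk⟩).1.1 = a := by
    intro k hk
    rcases h.arc ⟨k, hk⟩ with h' | h'
    · simp only [h'.1, true_and]
      constructor
      · intro hnum
        exact Sum.inl_injective (h.num_inj hG (e ⟨k, hk⟩).2 ha (h'.2.1.symm.trans hnum))
      · intro hka
        rw [← hka]
        exact h'.2.1
    · simp only [h'.1, false_and, iff_false]
      intro hnum
      have h1 := h'.2.1
      rw [h.num_inr] at h1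
      have := h.le_num hG ha
      simp only at h1
      omega
  refine Finset.card_bij (fun k hk => edgeOf e ⟨k, by simpa using (mem_filter.1 hk).1⟩) ?_ ?_ ?_
  · intro k hk
    rw [mem_filter, mem_range] at hk
    have := (key k hk.1).1 hk.2
    rw [mem_filter]
    exact ⟨this.1, by simp [edgeOf, this.2]⟩
  · intro k hk k' hk' heq
    simpa using edgeOf_injective e heq
  · intro x hx
    rw [mem_filter] at hx
    obtain ⟨v, rfl⟩ := Sym2.mem_iff_exists.1 hx.2
    have hadj : G.Adj (Sum.inl a) v := hF hx.1
    rcases adj_cases hG hadj with ⟨a', y, h1, rfl⟩ | ⟨a', y, h1, -⟩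
    · obtain ⟨k, rfl, rfl⟩ := exists_edgeOf_eq e hadj
      refine ⟨k, ?_, rfl⟩
      rw [mem_filter, mem_range, key k k.2]
      exact ⟨k.2, hx.1, rfl⟩
    · cases h1

end Encoding

/-! ### The position of the program in the schedule -/

section Cursor

variable {n : ℕ}

/-- After `i` passes the program stands at the vertex `l` with `c` passes for it done. At the end of
the schedule, `l = n` and `c = 0`. -/
def IsCursor (g : Fin n → ℕ) (i l c : ℕ) : Prop :=
  l ≤ n ∧ (∀ h : l < n, c < g ⟨l, h⟩) ∧ (l = n → c = 0) ∧
    (schedule (Equiv.refl (Fin n)) g).drop i =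
      (((List.finRange n).drop l).flatMap fun y => List.replicate (g y) y).drop c

theorem isCursor_zero {g : Fin n → ℕ} (hg : ∀ y, 0 < g y) : IsCursor g 0 0 0 :=
  ⟨Nat.zero_le _, fun _ => hg _, fun _ => rfl, rfl⟩

theorem drop_flatMap_finRange (g : Fin n → ℕ) {l : ℕ} (hl : l < n) :
    (((List.finRange n).drop l).flatMap fun y => List.replicate (g y) y) =
      List.replicate (g ⟨l, hl⟩) ⟨l, hl⟩ ++
        ((List.finRange n).drop (l + 1)).flatMap fun y => List.replicate (g y) y := by
  rw [List.drop_eq_getElem_cons (by simpa using hl), List.flatMap_cons]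
  simp

theorem IsCursor.lt_iff {g : Fin n → ℕ} {i l c : ℕ} (h : IsCursor g i l c) :
    l < n ↔ i < ∑ y, g y := by
  obtain ⟨h1, h2, h3, h4⟩ := h
  have hlen := congrArg List.length h4
  rw [List.length_drop, List.length_drop, length_schedule] at hlen
  constructor
  · intro hl
    rw [drop_flatMap_finRange g hl, List.length_append, List.length_replicate] at hlen
    have := h2 hl
    omega
  · intro hi
    by_contra hl
    obtain rfl : l = n := by omega
    rw [List.drop_of_length_le (l := List.finRange l) (by simp), List.flatMap_nil,
      List.length_nil] at hlen
    omega

theorem IsCursor.getElem? {g : Fin n → ℕ} {i l c : ℕ} (h : IsCursor g i l c) (hl : l < n) :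
    (schedule (Equiv.refl (Fin n)) g)[i]? = some ⟨l, hl⟩ := by
  obtain ⟨h1, h2, h3, h4⟩ := h
  have := congrArg (fun L => L[0]?) h4
  simp only [List.getElem?_drop, add_zero] at this
  rw [this, drop_flatMap_finRange g hl, List.getElem?_append_left (by simpa using h2 hl)]
  simp [h2 hl]

theorem IsCursor.next {g : Fin n → ℕ} (hg : ∀ y, 0 < g y) {i l c : ℕ} (h : IsCursor g i l c)
    (hl : l < n) :
    if c + 1 = g ⟨l, hl⟩ then IsCursor g (i + 1) (l + 1) 0 else IsCursor g (i + 1) l (c + 1) := by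
  obtain ⟨h1, h2, h3, h4⟩ := h
  have h5 := congrArg (List.drop 1) h4
  rw [List.drop_drop, List.drop_drop] at h5
  have hc := h2 hl
  split_ifs with h
  · refine ⟨hl, fun _ => hg _, fun _ => rfl, ?_⟩
    rw [h5, drop_flatMap_finRange g hl, List.drop_append_of_le_length (by simp; omega)]
    simp [h]
  · exact ⟨h1, fun _ => by omega, fun h => by omega, h5⟩

end Cursor

/-! ### The program carries out the algorithm -/

section Implementation

variable {p n m : ℕ} {G : SimpleGraph (Fin p ⊕ Fin n)}

/-- The cells that the program never changes have their initial values. -/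
structure Ready (e : Fin m ≃ EdgePair G) (g : Fin n → ℕ) (s : Store) : Prop where
  reg_one : s.reg 1 = n
  reg_two : s.reg 2 = m
  reg_five : s.reg 5 = 0
  arr_zero : s.arr 0 = cell g
  arr_one : s.arr 1 = cell fun k => ((e k).1.1 : ℕ)
  arr_two : s.arr 2 = cell fun k => ((e k).1.2 : ℕ)

theorem Ready.frame {e : Fin m ≃ EdgePair G} {g : Fin n → ℕ} {s s' : Store} {X U : Finset ℕ}
    (h : Ready e g s) (hf : Frame X U s s') (hX : Disjoint X {1, 2, 5} := by decide)
    (hU : Disjoint U {0, 1, 2} := by decide) : Ready e g s' := by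
  rw [Finset.disjoint_right] at hX hU
  exact ⟨(hf.reg 1 (hX (by simp))).trans h.reg_one, (hf.reg 2 (hX (by simp))).trans h.reg_two,
    (hf.reg 5 (hX (by simp))).trans h.reg_five, (hf.arr 0 (hU (by simp))).trans h.arr_zero,
    (hf.arr 1 (hU (by simp))).trans h.arr_one, (hf.arr 2 (hU (by simp))).trans h.arr_two⟩

theorem cell_val {m : ℕ} (f : Fin m → ℕ) (k : Fin m) : cell f k = f k := by simp [cell]

/-- The number of a vertex, where `rep` numbers the vertices of `A`. -/
def number (rep : ℕ → ℕ) : Fin p ⊕ Fin n → ℕ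
  | .inl a => rep a
  | .inr y => y

theorem encodes_of_arrays {e : Fin m ≃ EdgePair G} {F : Finset (Sym2 (Fin p ⊕ Fin n))}
    {rep tl hd ind : ℕ → ℕ}
    (hrep : ∀ k : Fin m, ∃ k' : Fin m, (e k').1.1 = (e k).1.1 ∧ rep (e k).1.1 = n + k')
    (hind : ∀ k : Fin m, ind k = if edgeOf e k ∈ F then 1 else 0)
    (htl : ∀ k : Fin m, tl k = if ind k = 0 then ((e k).1.2 : ℕ) else rep (e k).1.1)
    (hhd : ∀ k : Fin m, hd k = if ind k = 0 then rep (e k).1.1 else ((e k).1.2 : ℕ)) :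
    Encodes e F (number rep) tl hd := by
  refine ⟨fun k => ?_, fun y => rfl, fun k => ?_, fun k k' h => ?_⟩
  · rw [htl, hhd, hind]
    by_cases hk : edgeOf e k ∈ F
    · exact Or.inl ⟨hk, by simp [hk, number], by simp [hk, number]⟩
    · exact Or.inr ⟨hk, by simp [hk, number], by simp [hk, number]⟩
  · obtain ⟨k', -, h⟩ := hrep k
    simp only [number, h]
    omega
  · obtain ⟨i, hi, hi'⟩ := hrep k
    obtain ⟨j, hj, hj'⟩ := hrep k'
    simp only [number, hi', hj', add_right_inj] at h
    rw [← hi, ← hj, Fin.ext h]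

theorem ArcPath.nodup {tl hd : ℕ → ℕ} {src : ℕ} {L : List ℕ} {x : ℕ}
    (h : ArcPath m tl hd src L x) : L.Nodup := by
  induction h with
  | nil => exact List.nodup_nil
  | cons _ _ _ hL ih => exact List.nodup_cons.2 ⟨fun hk => hL _ hk rfl, ih⟩

theorem ArcPath.lt {tl hd : ℕ → ℕ} {src : ℕ} {L : List ℕ} {x : ℕ}
    (h : ArcPath m tl hd src L x) : ∀ k ∈ L, k < m := by
  induction h with
  | nil => simp
  | cons _ hk _ _ ih => exact List.forall_mem_cons.2 ⟨hk, ih⟩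

theorem ArcPath.length_le {tl hd : ℕ → ℕ} {src : ℕ} {L : List ℕ} {x : ℕ}
    (h : ArcPath m tl hd src L x) : L.length ≤ m := by
  have := Finset.card_le_card (s := L.toFinset) (t := range m) fun k hk =>
    mem_range.2 (h.lt k (List.mem_toFinset.1 hk))
  rwa [List.toFinset_card_of_nodup h.nodup, card_range] at this

theorem wp_pass (hG : G ≤ completeBipartiteGraph (Fin p) (Fin n)) {e : Fin m ≃ EdgePair G}
    {g : Fin n → ℕ} {F : Finset (Sym2 (Fin p ⊕ Fin n))}
    (hF : (F : Set (Sym2 (Fin p ⊕ Fin n))) ⊆ G.edgeSet) {l : Fin n}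
    (hlater : ∀ y, l < y → fdeg F (Sum.inr y) = 0)
    (hex : ∃ a, G.Adj (Sum.inr l) (Sum.inl a) ∧ s(Sum.inr l, Sum.inl a) ∉ F)
    {s : Store} (t : ℕ) (hs : Ready e g s) (hH : Holds e s F) (hl : s.reg 3 = l) :
    WP passCode s t fun t' s' => t' ≤ t + 61 * m + 25 ∧ Ready e g s' ∧
      (if s.reg 4 + 1 = g l then s'.reg 3 = l + 1 ∧ s'.reg 4 = 0
        else s'.reg 3 = l ∧ s'.reg 4 = s.reg 4 + 1) ∧
      ∃ F', Augments G (Equiv.refl (Fin n)) l F F' ∧ Holds e s' F' := by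
  refine WP.append ((wp_label s t).mono ?_)
  rintro t₁ s₁ ⟨ht₁, hf₁, hrep⟩
  have hs₁ := hs.frame hf₁
  refine WP.append ((wp_orient s₁ t₁ hs₁.reg_five).mono ?_)
  rintro t₂ s₂ ⟨ht₂, hf₂, hor⟩
  have hs₂ := hs₁.frame hf₂
  refine WP.append ((wp_link s₂ t₂).mono ?_)
  rintro t₃ s₃ ⟨ht₃, hf₃, hlink⟩
  have hs₃ := hs₂.frame hf₃
  rw [hs.reg_two, hs.reg_one, hs.arr_one] at hrep
  rw [hs₁.reg_two, hs₁.arr_one, hs₁.arr_two, hf₁.arr 3 (by decide)] at hor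
  have h53 : s₃.arr 5 = s₂.arr 5 := hf₃.arr 5 (by decide)
  have h63 : s₃.arr 6 = s₂.arr 6 := hf₃.arr 6 (by decide)
  have hx3 : s₃.arr 10 = s₂.arr 10 := hf₃.arr 10 (by decide)
  rw [hs₂.reg_two, ← h53] at hlink
  simp only [← h53, ← h63] at hor
  have hor' : ∀ k : Fin m,
      s₃.arr 5 k = (if s.arr 3 k = 0 then ((e k).1.2 : ℕ) else s₁.arr 4 (e k).1.1) ∧
      s₃.arr 6 k = (if s.arr 3 k = 0 then s₁.arr 4 (e k).1.1 else ((e k).1.2 : ℕ)) ∧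
      ∀ v, v = ((e k).1.2 : ℕ) ∨ v = s₁.arr 4 (e k).1.1 →
          s₂.arr 7 v = 0 ∧ s₂.arr 9 v = 0 ∧ s₂.arr 10 v = 0 := by
    intro k
    have := hor k k.2
    rwa [cell_val, cell_val] at this
  have henc : Encodes e F (number (s₁.arr 4)) (s₃.arr 5) (s₃.arr 6) := by
    refine encodes_of_arrays (ind := s.arr 3) (fun k => ?_) hH (fun k => (hor' k).1)
      (fun k => (hor' k).2.1)
    obtain ⟨i, hi, h1, h2⟩ := hrep k k.2
    rw [cell_val] at h1 h2
    exact ⟨⟨i, hi⟩, Fin.ext (by simpa [cell, hi] using h1), h2⟩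
  -- Only the cells of non-isolated vertices are reset: `p` may be far larger than `m`.
  have hzero : ∀ u v, G.Adj u v → s₂.arr 7 (number (s₁.arr 4) u) = 0 ∧
      s₂.arr 9 (number (s₁.arr 4) u) = 0 ∧ s₂.arr 10 (number (s₁.arr 4) u) = 0 := by
    intro u v huv
    rcases adj_cases hG huv with ⟨a, y, rfl, rfl⟩ | ⟨a, y, rfl, rfl⟩
    · obtain ⟨k, rfl, rfl⟩ := exists_edgeOf_eq e huv
      exact (hor' k).2.2 _ (Or.inr rfl)
    · obtain ⟨k, rfl, rfl⟩ := exists_edgeOf_eq e huv.symm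
      exact (hor' k).2.2 _ (Or.inl rfl)
  have hhead : ∀ k < m, ∃ u v, G.Adj u v ∧ s₃.arr 6 k = number (s₁.arr 4) u := by
    intro k hk
    obtain ⟨u, v, huv, -, -, h, -⟩ := henc.exists_arc ⟨k, hk⟩
    exact ⟨v, u, huv.symm, h⟩
  obtain ⟨a₀, ha₀, ha₀F⟩ := hex
  have hl₃ : s₃.reg 3 = number (p := p) (s₁.arr 4) (Sum.inr l) := by
    rw [hf₃.reg 3 (by decide), hf₂.reg 3 (by decide), hf₁.reg 3 (by decide), hl]
    rfl
  refine WP.append ((wp_search s₃ t₃ hs₃.reg_five ?_ ?_).mono ?_)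
  · rw [hs₃.reg_two, hl₃]
    rintro v (rfl | ⟨k, hk, rfl⟩)
    · have := hzero _ _ ha₀
      exact (hlink _ this.1 this.2.1).1
    · obtain ⟨u, v, huv, h⟩ := hhead k hk
      have := hzero _ _ huv
      rw [h]
      exact (hlink _ this.1 this.2.1).1
  · rw [hs₃.reg_two]
    intro k hk
    obtain ⟨u, v, huv, h⟩ := hhead k hk
    rw [hx3, h]
    exact (hzero _ _ huv).2.2
  rintro t₄ s₄ ⟨ht₄, hf₄, h13, hS, hclosed⟩
  have hs₄ := hs₃.frame hf₄
  rw [hs₃.reg_two, hl₃] at hS hclosed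
  have h64 : s₄.arr 6 = s₃.arr 6 := hf₄.arr 6 (by decide)
  have h94 : s₄.arr 9 = s₃.arr 9 := hf₄.arr 9 (by decide)
  have hdeg : ∀ (a : Fin p) v, G.Adj (Sum.inl a) v →
      s₄.arr 9 (number (n := n) (s₁.arr 4) (Sum.inl a)) = fdeg F (Sum.inl a) := by
    intro a v hav
    have := hzero _ _ hav
    rw [h94, (hlink _ this.1 this.2.1).2, henc.fdeg_eq hG hF hav]
  -- The marked vertices are closed under arcs, so every reachable vertex occurs in the queue.
  have hreach : ∀ v (Q : G.Walk (Sum.inr l) v), Directed F Q →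
      number (s₁.arr 4) v = number (p := p) (s₁.arr 4) (Sum.inr l) ∨
        ∃ j < s₄.reg 8, s₃.arr 6 (s₄.arr 11 j) = number (s₁.arr 4) v := by
    intro v Q hQ
    refine hQ.mem_of_closed (S := {u | number (s₁.arr 4) u =
      number (p := p) (s₁.arr 4) (Sum.inr l) ∨
        ∃ j < s₄.reg 8, s₃.arr 6 (s₄.arr 11 j) = number (s₁.arr 4) u}) ?_ (Or.inl rfl)
    intro u hu w huw harc
    obtain ⟨k, hk, htl, hhd⟩ := henc.exists_index hG huw harc
    simp only [Set.mem_ofPred_eq, ← htl, ← hhd] at hu ⊢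
    exact (hS.vis_iff k hk).1 (hclosed k hk hu)
  have hreachA : ∀ a (Q : G.Walk (Sum.inr l) (Sum.inl a)), Directed F Q →
      n ≤ number (n := n) (s₁.arr 4) (Sum.inl a) ∧ (∃ v, G.Adj (Sum.inl a) v) ∧
        ∃ j < s₄.reg 8, s₃.arr 6 (s₄.arr 11 j) = number (n := n) (s₁.arr 4) (Sum.inl a) := by
    intro a Q hQ
    have hnil : ¬ Q.Nil := fun h => by simpa using h.eq
    have hadj := (Q.adj_penultimate hnil).symm
    have hn := henc.le_num hG hadj
    refine ⟨hn, ⟨_, hadj⟩, (hreach _ Q hQ).resolve_left fun h => ?_⟩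
    rw [h, henc.num_inr] at hn
    exact absurd l.2 (not_lt.2 hn)
  refine WP.append ((wp_pick s₄ t₄ ?_ ?_).mono ?_)
  · intro j hj
    rw [h64, hs₄.reg_two, h94]
    obtain ⟨u, v, huv, h⟩ := hhead _ (hS.que_lt j hj)
    have := hzero _ _ huv
    rw [h, (hlink _ this.1 this.2.1).2, length_outList]
    exact (card_filter_le _ _).trans (card_range m).le
  · rw [h64, hs₄.reg_one]
    obtain ⟨h1, -, j, hj, h⟩ := hreachA a₀ (.cons ha₀ .nil) (by simpa [Arc] using ha₀F)
    exact ⟨j, hj, h ▸ h1⟩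
  rintro t₅ s₅ ⟨ht₅, hf₅, i, hi, hbest, hin, hmin⟩
  have hs₅ := hs₄.frame hf₅
  rw [hs₄.reg_one, h64] at hin hmin
  obtain ⟨L, hL1, hL2, -⟩ := hS.path i hi
  rw [← hf₅.arr 12 (by simp), ← hbest] at hL1
  refine WP.append ((wp_flip s₅ t₅ hs₅.reg_five ((hf₅.reg 13 (by decide)).trans h13) hL1
    hL2.nodup).mono ?_)
  rintro t₆ s₆ ⟨ht₆, hf₆, hflip⟩
  have hs₆ := hs₅.frame hf₆
  refine (wp_advance s₆ t₆).mono ?_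
  rintro t₇ s₇ ⟨ht₇, hf₇, hadv⟩
  have hle := hS.le
  have hlen := hL2.length_le
  refine ⟨?_, hs₆.frame hf₇, ?_, ?_⟩
  · rw [hs.reg_two] at ht₁
    rw [hs₁.reg_two] at ht₂
    rw [hs₂.reg_two] at ht₃
    rw [hs₃.reg_two] at ht₄
    omega
  · have h3 : s₆.reg 3 = l := by
      rw [hf₆.reg 3 (by decide), hf₅.reg 3 (by decide), hf₄.reg 3 (by decide), hl₃]
      rfl
    have h4 : s₆.reg 4 = s.reg 4 := by
      rw [hf₆.reg 4 (by decide), hf₅.reg 4 (by decide), hf₄.reg 4 (by decide),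
        hf₃.reg 4 (by decide), hf₂.reg 4 (by decide), hf₁.reg 4 (by decide)]
    rwa [h3, h4, hs₆.arr_zero, cell_val] at hadv
  · obtain ⟨v, P, hv, hP, hPd, -, hPL, -⟩ := henc.exists_walk hG ha₀ hL2
    have h3 : s₅.arr 3 = s.arr 3 := by
      rw [hf₅.arr 3 (by decide), hf₄.arr 3 (by decide), hf₃.arr 3 (by decide),
        hf₂.arr 3 (by decide), hf₁.arr 3 (by decide)]
    rcases v with a | y
    · refine ⟨_, augments_of_directed hG hlater hP hPd fun a' Q hQ => ?_, fun k => ?_⟩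
      · obtain ⟨-, ⟨w, hw⟩, -⟩ := hreachA a P hPd
        obtain ⟨hn, ⟨w', hw'⟩, j, hj, hja⟩ := hreachA a' Q hQ
        rw [← hdeg a w hw, ← hdeg a' w' hw', hv, ← hja]
        exact hmin j hj (hja ▸ hn)
      · have hk : (k : ℕ) ∈ L ↔ edgeOf e k ∈ P.edges := (hPL k).symm
        have hHk : s.arr 3 k = if edgeOf e k ∈ F then 1 else 0 := hH k
        rw [hf₇.arr 3 (by simp), hflip, h3, hHk]
        change _ = if edgeOf e k ∈ symmDiff F P.edges.toFinset then 1 else 0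
        simp only [hk, Finset.mem_symmDiff, List.mem_toFinset]
        by_cases h1 : edgeOf e k ∈ P.edges <;> by_cases h2 : edgeOf e k ∈ F <;> simp [h1, h2]
    · rw [← hv, henc.num_inr] at hin
      exact absurd y.2 (not_lt.2 hin)

/-- A sequence built step by step, each step being possible under an invariant. -/
theorem exists_seq_of_step {α : Type*} {N : ℕ} {I : ℕ → α → Prop} {R : ℕ → α → α → Prop} {x₀ : α}
    (h0 : I 0 x₀) (hstep : ∀ i < N, ∀ x, I i x → ∃ y, I (i + 1) y ∧ R i x y) :
    ∃ x : ℕ → α, x 0 = x₀ ∧ (∀ i ≤ N, I i (x i)) ∧ ∀ i < N, R i (x i) (x (i + 1)) := by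
  classical
  let f : ℕ → α → α := fun i x => if h : ∃ y, I (i + 1) y ∧ R i x y then h.choose else x
  let x : ℕ → α := fun i => Nat.rec x₀ f i
  have hf : ∀ i < N, ∀ y, I i y → I (i + 1) (f i y) ∧ R i y (f i y) := by
    intro i hi y hy
    have h := hstep i hi y hy
    simp only [f, dif_pos h]
    exact h.choose_spec
  have hI : ∀ i ≤ N, I i (x i) := by
    intro i
    induction i with
    | zero => exact fun _ => h0
    | succ i ih => exact fun hi => (hf i hi _ (ih (by omega))).1
  exact ⟨x, rfl, hI, fun i hi => (hf i hi _ (hI i hi.le)).2⟩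

theorem implements_mainCode (hn : 0 < n) (hG : G ≤ completeBipartiteGraph (Fin p) (Fin n))
    (e : Fin m ≃ EdgePair G) {g : Fin n → ℕ} (hg : ∀ y, 0 < g y)
    (hq : ∃ F, IsQuasiMatching G g univ F) :
    Implements mainCode G e g (88 * G.edgeSet.ncard) (88 * ((∑ y, g y) * G.edgeSet.ncard)) := by
  rw [ncard_edgeSet hG e]
  have hm : 0 < m := by
    obtain ⟨a, ha, -⟩ := (reached_zero (G := G) (Equiv.refl (Fin n)) g).exists_edge hG hq
      ((isCursor_zero hg).getElem? hn)
    obtain ⟨k, -⟩ := exists_edgeOf_eq e ha.symm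
    exact k.pos
  let I : ℕ → ℕ × Store × Finset (Sym2 (Fin p ⊕ Fin n)) → Prop := fun i x =>
    runFor mainCode (inputStore e g) x.1 = (mainCode, x.2.1) ∧ Ready e g x.2.1 ∧
      Holds e x.2.1 x.2.2 ∧ Reached G (Equiv.refl (Fin n)) g i x.2.2 ∧
      IsCursor g i (x.2.1.reg 3) (x.2.1.reg 4)
  let R : ℕ → ℕ × Store × Finset (Sym2 (Fin p ⊕ Fin n)) →
      ℕ × Store × Finset (Sym2 (Fin p ⊕ Fin n)) → Prop := fun i x y =>
    Pass G (Equiv.refl (Fin n)) g i x.2.2 y.2.2 ∧ x.1 ≤ y.1 ∧ y.1 ≤ x.1 + 87 * m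
  have h0 : I 0 (0, inputStore e g, ∅) := by
    refine ⟨rfl, ⟨rfl, rfl, rfl, rfl, rfl, rfl⟩, ?_, reached_zero _ g, isCursor_zero hg⟩
    intro k
    simp [inputStore]
  have hstep : ∀ i < ∑ y, g y, ∀ x, I i x → ∃ y, I (i + 1) y ∧ R i x y := by
    rintro i hi ⟨t, s, F⟩ ⟨hrun, hs, hH, hR, hc⟩
    simp only at hrun hs hH hR hc
    have hl := hc.lt_iff.2 hi
    have hsched := hc.getElem? hl
    obtain ⟨s', d, hd, ht', hs', hnext, F', hF', hH'⟩ := wp_pass hG hR.subset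
      (l := ⟨s.reg 3, hl⟩) (fun y hy => hR.fdeg_later hsched y hy) (hR.exists_edge hG hq hsched)
      (t + 1) hs hH rfl
    have hpass : Pass G (Equiv.refl (Fin n)) g i F F' := ⟨_, hsched, hF'⟩
    refine ⟨(t + 1 + d, s', F'), ⟨?_, hs', hH', hR.pass hG hpass, ?_⟩, hpass, ?_, ?_⟩
    · have h1 : step (mainCode, s) = (passCode ++ mainCode, s) := by
        simp [step, mainCode, hs.reg_one, hl]
      rw [runFor] at hrun ⊢
      simp only
      rw [show t + 1 + d = d + 1 + t by ring, Function.iterate_add_apply, hrun,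
        Function.iterate_succ_apply, h1, hd]
    · have := hc.next hg hl
      simp only at hnext ⊢
      split_ifs at this hnext with hcg
      · rwa [hnext.1, hnext.2]
      · rwa [hnext.1, hnext.2]
    · simp only; omega
    · simp only; omega
  obtain ⟨x, hx0, hxI, hxR⟩ := exists_seq_of_step h0 hstep
  have htime : ∀ i ≤ ∑ y, g y, (x i).1 ≤ 87 * (i * m) := by
    intro i
    induction i with
    | zero => simp [hx0]
    | succ i ih =>
      intro hi
      have h1 := ih (by omega)
      have h2 := (hxR i hi).2.2
      rw [Nat.add_mul, one_mul]
      omega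
  obtain ⟨hrun, hs, hH, -, hc⟩ := hxI _ le_rfl
  have hlast : runFor mainCode (inputStore e g) ((x (∑ y, g y)).1 + 1) =
      ([], (x (∑ y, g y)).2.1) := by
    have hnl : ¬ (x (∑ y, g y)).2.1.reg 3 < n := fun h => lt_irrefl _ (hc.lt_iff.1 h)
    rw [runFor] at hrun ⊢
    rw [Function.iterate_succ_apply', hrun]
    simp [step, mainCode, hs.reg_one, hnl]
  refine ⟨fun i => (x i).2.2, fun i => (x i).1, (x (∑ y, g y)).1 + 1,
    ⟨by simp [hx0], fun i hi => (hxR i hi).1⟩, ?_, ?_, by simp, ?_, by rw [hlast], by rwa [hlast]⟩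
  · intro i hi
    simp only
    rw [(hxI i hi).1]
    exact (hxI i hi).2.2.1
  · intro i hi
    have := (hxR i hi).2
    simp only
    omega
  · have h1 := htime _ le_rfl
    have h2 : 0 < ∑ y, g y := (isCursor_zero hg).lt_iff.1 hn
    have h3 := Nat.mul_pos h2 hm
    omega

end Implementation

end QuasiMatching

theorem corollary3p3 :
    -- correctness: no execution gets stuck, and every execution returns a minimum quasi-matching
    (∀ (A B : Type*) [Fintype A] [Fintype B] [DecidableEq A] [DecidableEq B]
      (G : SimpleGraph (A ⊕ B)) (_ : G ≤ completeBipartiteGraph A B)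
      (n : ℕ) (b : Fin n ≃ B) (g : B → ℕ)
      (_ : ∃ F, QuasiMatching.IsQuasiMatching G g Finset.univ F),
      (∀ (k : ℕ) (F : ℕ → Finset (Sym2 (A ⊕ B))), k < ∑ y, g y →
        QuasiMatching.IsExecution G b g k F → ∃ F', QuasiMatching.Pass G b g k (F k) F') ∧
      (∀ F : ℕ → Finset (Sym2 (A ⊕ B)), QuasiMatching.IsExecution G b g (∑ y, g y) F →
        QuasiMatching.IsMinimum G g Finset.univ (F (∑ y, g y)))) ∧
    -- running time: `O(|E(G)|)` for each pass and `O(g(B) |E(G)|)` in total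
    (∃ (P : List QuasiMatching.Instr) (C : ℕ),
      ∀ (p n m : ℕ) (_ : 0 < n)
        (G : SimpleGraph (Fin p ⊕ Fin n)) (_ : G ≤ completeBipartiteGraph (Fin p) (Fin n))
        (e : Fin m ≃ QuasiMatching.EdgePair G)
        (g : Fin n → ℕ) (_ : ∀ y, 0 < g y)
        (_ : ∃ F, QuasiMatching.IsQuasiMatching G g Finset.univ F),
        QuasiMatching.Implements P G e g
          (C * G.edgeSet.ncard) (C * ((∑ y, g y) * G.edgeSet.ncard))) := by
  refine ⟨?_, QuasiMatching.mainCode, 88, ?_⟩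
  · intro A B _ _ _ _ G hG n b g hq
    exact ⟨fun k F hk hF => hF.exists_pass hG hq hk, fun F hF => hF.isMinimum hG⟩
  · intro p n m hn G hG e g hg hq
    exact QuasiMatching.implements_mainCode hn hG e hg hq
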